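/- **Conventions.** $\mathbb N=\{1,2,\dots\}$; $[M]^\infty$ is the set of infinite subsets of $M\subseteq\mathbb N$; $s(k)$ and $M(k)$ denote the $k$-th elements, in increasing order, of $s$ and $M$; $t\sqsubseteq s$ means that $t$ is an initial segment of $s$. A family $\mathcal F$ of finite subsets of $\mathbb N$ is *regular thin* if no member is a proper initial segment of another member and $\widehat{\mathcal F}=\{t:\ t\sqsubseteq s \text{ for some } s\in\mathcal F\}$ is closed in $\{0,1\}^{\mathbb N}$ (via characteristic functions), hereditary (closed under subsets) and spreading (if $\{n_1<\dots<n_k\}\in\widehat{\mathcal F}$, $m_1<\dots<m_k$ and $n_i\le m_i$ for all $i$, then $\{m_1,\dots,m_k\}\in\widehat{\mathcal F}$). Nonempty finite sets $s_1,\dots,s_l$ form a *plegma family* if $s_i(k)<s_j(k)$ for all $i<j$ and $k\le\min(|s_i|,|s_j|)$, and $s_i(k)<s_j(k+1)$ for all $i,j$ and $k\le\min(|s_i|,|s_j|-1)$. Write $\mathcal F\upharpoonright M=\{s\in\mathcal F: s\subseteq M\}$. All vector spaces are real. Let $(x_s)_{s\in\mathcal F}$ be a family in a Banach space $X$ and $M\in[\mathbb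 N]^\infty$. The subsequence $(x_s)_{s\in\mathcal F\upharpoonright M}$ *generates* a linearly independent sequence $(e_n)$ in a seminormed space $(E,\|\cdot\|_*)$ as an $\mathcal F$-spreading model if there are positive reals $\delta_l\to0$ such that $$\Big|\,\Big\|\sum_{j=1}^k a_jx_{s_j}\Big\|-\Big\|\sum_{j=1}^k a_je_j\Big\|_*\Big|\le\delta_l$$ whenever $1\le k\le l$, $a_1,\dots,a_k\in[-1,1]$, and $(s_j)_{j=1}^k$ is a plegma family in $\mathcal F\upharpoonright M$ with $s_1(1)\ge M(l)$. The subsequence $(x_s)_{s\in\mathcal F\upharpoonright L}$ *admits $(e_n)$ as its unique (up to isometry) $\mathcal F$-spreading model* if $(x_s)_{s\in\mathcal F\upharpoonright N}$ generates $(e_n)$ for some $N\in[L]^\infty$, and for every $N\in[L]^\infty$ and every sequence $(\tilde e_n)$ generated by $(x_s)_{s\in\mathcal F\upharpoonright N}$ as an $\mathcal F$-spreading model, $\|\sum_{i=1}^n a_i\tilde e_i\|=\|\sum_{i=1}^n a_ie_i\|$ for all $n$ and all $a_1,\dots,a_n\in\mathbb R$. A sequence $(e_n)$ in a seminormed space is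 *singular* if it is spreading ($\|\sum_{j\le n}a_je_j\|_*=\|\sum_{j\le n}a_je_{k_j}\|_*$ for all $n$, all scalars and all $k_1<\dots<k_n$), is nontrivial ($\|e_n-e_m\|_*\ne0$ for some $n,m$), and is not Schauder basic (there is no $C\ge1$ with $\|\sum_{n\le k}a_ne_n\|_*\le C\|\sum_{n\le m}a_ne_n\|_*$ for all $k\le m$ and all scalars). Its *natural decomposition* is $e_n=e_n'+e$, where $e$ is the weak limit of $(e_n)$ in the completion of $E$. **Theorem 6.16.** Let $\mathcal F$ be a regular thin family with at least one nonempty member, let $M\in[\mathbb N]^\infty$, and let $(x_s)_{s\in\mathcal F}$ be a family in a Banach space $X$ such that $(x_s)_{s\in\mathcal F\upharpoonright M}$ generates a singular $\mathcal F$-spreading model $(e_n)$. Then $(e_n)$ has a natural decomposition $e_n=e_n'+e$, and there are $x\in X$ with $\|x\|=\|e\|_*$ and $L\in[M]^\infty$ such that $(x_s-x)_{s\in\mathcal F\upharpoonright L}$ admits $(e_n')$ as its unique (up to isometry) $\mathcal F$-spreading model. -/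

import Mathlib

open Filter Topology

universe u v w

/-! Finite subsets of `ℕ`.  The positive integers `{1 < 2 < ⋯}` are replaced by the order-isomorphic
set `ℕ = {0 < 1 < ⋯}`; all notions below depend only on the order.  Enumerations start at `0`:
`Nat.nth (· ∈ A) k` is the element of `A` that has exactly `k` predecessors in `A`. -/

/-- `t` is an initial segment of `s`. -/
def IsInitialSegment (t s : Finset ℕ) : Prop :=
  t ⊆ s ∧ ∀ a ∈ s, ∀ b ∈ t, a ≤ b → a ∈ t

/-- The closure of a family under initial segments. -/
def initialClosure (F : Set (Finset ℕ)) : Set (Finset ℕ) :=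
  {t | ∃ s ∈ F, IsInitialSegment t s}

/-- No member of the family is a proper initial segment of another member. -/
def IsThinFamily (F : Set (Finset ℕ)) : Prop :=
  ∀ s ∈ F, ∀ t ∈ F, IsInitialSegment s t → s = t

/-- The family is closed under subsets. -/
def IsHereditaryFamily (R : Set (Finset ℕ)) : Prop :=
  ∀ s ∈ R, ∀ t : Finset ℕ, t ⊆ s → t ∈ R

/-- If `n₁ < ⋯ < n_k`, `m₁ < ⋯ < m_k`, `n_i ≤ m_i` and `{n₁, …, n_k}` is in the family, then so is
`{m₁, …, m_k}`. -/
def IsSpreadingFamily (R : Set (Finset ℕ)) : Prop :=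
  ∀ (k : ℕ) (n m : Fin k → ℕ), StrictMono n → StrictMono m → (∀ i, n i ≤ m i) →
    Finset.univ.image n ∈ R → Finset.univ.image m ∈ R

/-- The characteristic functions of the members form a closed subset of `{0,1}^ℕ`. -/
def IsCompactFamily (R : Set (Finset ℕ)) : Prop :=
  IsClosed {χ : ℕ → Bool | ∃ s ∈ R, χ = fun n => decide (n ∈ s)}

/-- Regular families: compact, hereditary and spreading. -/
def IsRegularFamily (R : Set (Finset ℕ)) : Prop :=
  IsCompactFamily R ∧ IsHereditaryFamily R ∧ IsSpreadingFamily R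

/-- Regular thin families: thin, and the closure under initial segments is regular. -/
def IsRegularThin (F : Set (Finset ℕ)) : Prop :=
  IsThinFamily F ∧ IsRegularFamily (initialClosure F)

/-- A plegma family `(s_j)` of nonempty finite sets: `s_i(k) < s_j(k)` for `i < j`, and
`s_i(k) < s_j(k+1)` for all `i, j`, whenever these elements exist. -/
def IsPlegma {l : ℕ} (s : Fin l → Finset ℕ) : Prop :=
  (∀ i, (s i).Nonempty) ∧
  (∀ i j, i < j → ∀ k, k < (s i).card → k < (s j).card →
    Nat.nth (· ∈ s i) k < Nat.nth (· ∈ s j) k) ∧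
  (∀ i j, ∀ k, k < (s i).card → k + 1 < (s j).card →
    Nat.nth (· ∈ s i) k < Nat.nth (· ∈ s j) (k + 1))

/-! Sequences in seminormed spaces. -/

/-- `‖∑ a_j e_j‖ = ‖∑ a_j e_{k_j}‖` for all scalars `a₁, …, a_n` and `k₁ < ⋯ < k_n`. -/
def IsSpreadingSeq {E : Type v} [SeminormedAddCommGroup E] [NormedSpace ℝ E] (e : ℕ → E) : Prop :=
  ∀ (n : ℕ) (a : Fin n → ℝ) (k : Fin n → ℕ), StrictMono k →
    ‖∑ j : Fin n, a j • e (j : ℕ)‖ = ‖∑ j : Fin n, a j • e (k j)‖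

/-- Triviality of a (spreading) sequence: all distances between its terms vanish. -/
def IsTrivialSeq {E : Type v} [SeminormedAddCommGroup E] (e : ℕ → E) : Prop :=
  ∀ n m : ℕ, ‖e n - e m‖ = 0

/-- Initial partial sums are dominated, uniformly, by longer ones. -/
def IsSchauderBasic {E : Type v} [SeminormedAddCommGroup E] [NormedSpace ℝ E] (e : ℕ → E) :
    Prop :=
  ∃ C : ℝ, 1 ≤ C ∧ ∀ k m : ℕ, k ≤ m → ∀ a : ℕ → ℝ,
    ‖∑ n ∈ Finset.range k, a n • e n‖ ≤ C * ‖∑ n ∈ Finset.range m, a n • e n‖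

/-- Singular sequences: nontrivial spreading sequences which are not Schauder basic. -/
def IsSingularSeq {E : Type v} [SeminormedAddCommGroup E] [NormedSpace ℝ E] (e : ℕ → E) : Prop :=
  IsSpreadingSeq e ∧ ¬ IsTrivialSeq e ∧ ¬ IsSchauderBasic e

/-- The natural decomposition `e_n = e'_n + e₀` of a sequence, where `e₀` is the limit of `(e_n)` in
the weak topology of the completion of `E` (the Banach space associated with `E`). -/
def IsNaturalDecomposition {E : Type v} [SeminormedAddCommGroup E] [NormedSpace ℝ E] (e : ℕ → E)
    (e₀ : UniformSpace.Completion E) (e' : ℕ → UniformSpace.Completion E) : Prop :=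
  (∀ f : UniformSpace.Completion E →L[ℝ] ℝ,
    Tendsto (fun n => f (e n : UniformSpace.Completion E)) atTop (𝓝 (f e₀))) ∧
  ∀ n, (e n : UniformSpace.Completion E) = e' n + e₀

/-- Two sequences are isometric: linear combinations with equal scalars have equal norms. -/
def IsIsometricSeq {E : Type v} [SeminormedAddCommGroup E] [NormedSpace ℝ E]
    {H : Type w} [SeminormedAddCommGroup H] [NormedSpace ℝ H] (e : ℕ → E) (f : ℕ → H) : Prop :=
  ∀ (n : ℕ) (a : ℕ → ℝ),
    ‖∑ i ∈ Finset.range n, a i • e i‖ = ‖∑ i ∈ Finset.range n, a i • f i‖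

/-! Spreading models. -/

/-- The subsequence of the `F`-sequence `(x_s)` of those `s ∈ F` with `s ⊆ M` generates `(e_n)` as
an `F`-spreading model.  Here `(e_n)` is a Hamel basis of the space it spans, and `(δ_l)` is a null
sequence of positive reals such that
`| ‖a_0 x_{s_0} + ⋯ + a_k x_{s_k}‖ - ‖a_0 e_0 + ⋯ + a_k e_k‖ | ≤ δ_l`
for all `k ≤ l`, all `a_j ∈ [-1,1]`, and all plegma families `(s_0, …, s_k)` of members of `F`
contained in `M` with `min s_0 ≥ M(l)`. -/
def GeneratesSpreadingModel {X : Type u} [SeminormedAddCommGroup X] [NormedSpace ℝ X]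
    {E : Type v} [SeminormedAddCommGroup E] [NormedSpace ℝ E]
    {F : Set (Finset ℕ)} (x : F → X) (M : Set ℕ) (e : ℕ → E) : Prop :=
  LinearIndependent ℝ e ∧
  ∃ δ : ℕ → ℝ, (∀ l, 0 < δ l) ∧ Tendsto δ atTop (𝓝 0) ∧
    ∀ (l k : ℕ), k ≤ l → ∀ (a : Fin (k + 1) → ℝ), (∀ j, a j ∈ Set.Icc (-1 : ℝ) 1) →
      ∀ s : Fin (k + 1) → F, IsPlegma (fun j => (s j : Finset ℕ)) →
        (∀ j, ∀ n ∈ (s j : Finset ℕ), n ∈ M) →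
        (∀ n ∈ (s 0 : Finset ℕ), Nat.nth (· ∈ M) l ≤ n) →
        |‖∑ j, a j • x (s j)‖ - ‖∑ j : Fin (k + 1), a j • e (j : ℕ)‖| ≤ δ l

/-- The subsequence of `(x_s)` of those `s ∈ F` with `s ⊆ L` admits `(e_n)` as its unique, up to
isometry, `F`-spreading model: some further subsequence generates `(e_n)`, and every sequence
generated by a further subsequence is isometric to `(e_n)`. -/
def AdmitsUniqueSpreadingModel {X : Type u} [SeminormedAddCommGroup X] [NormedSpace ℝ X]
    {E : Type v} [SeminormedAddCommGroup E] [NormedSpace ℝ E]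
    {F : Set (Finset ℕ)} (x : F → X) (L : Set ℕ) (e : ℕ → E) : Prop :=
  (∃ N : Set ℕ, N ⊆ L ∧ N.Infinite ∧ GeneratesSpreadingModel x N e) ∧
  ∀ N : Set ℕ, N ⊆ L → N.Infinite →
    ∀ (H : Type w) [SeminormedAddCommGroup H] [NormedSpace ℝ H] (f : ℕ → H),
      GeneratesSpreadingModel x N f → IsIsometricSeq e f

/-! ### Cesàro means of singular spreading sequences -/

section Sequences

variable {E : Type v} [SeminormedAddCommGroup E] [NormedSpace ℝ E]

/-! Failure of the basis inequality yields a normalised combination u of the e_n that barely moves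
when its support is spread out (`IsSpreadingSeq.exists_almost_invariant`). An average of translates
of u is close to u and also to a fixed multiple of a Cesàro mean of (e_n). Hence the means of all
subsequences converge, at a common rate, to one vector y of the completion. This y is the weak
limit, and e_n - y is again spreading because y can be replaced by far-out means
(`HasUniformMean.norm_sum_sub`).

Means of x over plegma families should play the role of y in X: if two families concatenate to a
plegma family, the difference of their means has nearly the norm of a difference of two means of
(e_n), which is small. Arbitrary families do not concatenate, so M is thinned to a sequence cut into
slots, and families are read off along increasing sequences h of slots in such a way that the family
along h concatenates with the one along the shift of h. Means along consecutive slots are Cauchy,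
with limit z; an eventually consecutive h reaches the same z after finitely many shifts
(`SlotScheme.norm_pathMean_sub_limit_le`).

L is the set of slot marks. A plegma family (s_j) in L is followed by such an h
(`IsPlegmaUpTo.exists_guide`), so the family along h can be appended to it. Replacing z and y by
means, the spreading model estimate compares ∑ a_j (x_{s_j} - z) with ∑ a_j (e_j - y)
(`SlotScheme.abs_norm_sum_sub_le`). Uniqueness holds because every infinite subset of L contains
plegma families of any length arbitrarily far out. -/

/-- The mean of the first `n` terms. -/
noncomputable def cesaroMean (e : ℕ → E) (n : ℕ) : E :=
  (n : ℝ)⁻¹ • ∑ i ∈ Finset.range n, e i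

theorem IsSpreadingSeq.norm_sum_range {e : ℕ → E} (he : IsSpreadingSeq e) (n : ℕ) (a : ℕ → ℝ)
    {P : ℕ → ℕ} (hP : StrictMono P) :
    ‖∑ j ∈ Finset.range n, a j • e (P j)‖ = ‖∑ j ∈ Finset.range n, a j • e j‖ := by
  have := he n (fun j => a j) (fun j => P j) (fun i j h => hP h)
  rw [Finset.sum_range, Finset.sum_range]
  exact this.symm

theorem IsSpreadingSeq.norm_eq {e : ℕ → E} (he : IsSpreadingSeq e) (n : ℕ) : ‖e n‖ = ‖e 0‖ := by
  have h := he.norm_sum_range 1 (fun _ => 1) (P := fun j => j + n) (fun i j h => by simpa using h)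
  simpa using h

/-- A tail nearly cancels a head that is much larger than the whole sum. By spreading, one far-out
copy of the tail nearly cancels each spread copy of the head, so these copies are close to each
other. -/
theorem IsSpreadingSeq.exists_almost_invariant {e : ℕ → E} (he : IsSpreadingSeq e)
    (hb : ¬ IsSchauderBasic e) {η : ℝ} (hη : 0 < η) :
    ∃ (k : ℕ) (a : ℕ → ℝ), ‖∑ n ∈ Finset.range k, a n • e n‖ = 1 ∧
      ∀ P : ℕ → ℕ, StrictMono P →
        ‖∑ n ∈ Finset.range k, a n • e (P n) - ∑ n ∈ Finset.range k, a n • e n‖ ≤ η := by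
  unfold IsSchauderBasic at hb
  push Not at hb
  obtain ⟨k, m, hkm, a, ha⟩ := hb (max 1 (2 / η)) (le_max_left _ _)
  obtain ⟨d, rfl⟩ := Nat.exists_eq_add_of_le hkm
  set u := ‖∑ n ∈ Finset.range k, a n • e n‖ with hu
  have hC : 2 / η ≤ max 1 (2 / η) := le_max_right _ _
  have hupos : 0 < u := lt_of_le_of_lt (by positivity) ha
  have hsmall : ‖∑ n ∈ Finset.range (k + d), a n • e n‖ ≤ η / 2 * u := by
    have h1 : 2 / η * ‖∑ n ∈ Finset.range (k + d), a n • e n‖ ≤ u :=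
      (mul_le_mul_of_nonneg_right hC (norm_nonneg _)).trans ha.le
    have h2 := mul_le_mul_of_nonneg_left h1 (by positivity : 0 ≤ η / 2)
    have h3 : η / 2 * (2 / η * ‖∑ n ∈ Finset.range (k + d), a n • e n‖)
        = ‖∑ n ∈ Finset.range (k + d), a n • e n‖ := by field_simp
    rwa [h3] at h2
  have key : ∀ P : ℕ → ℕ, StrictMono P → ∀ T, P k ≤ T →
      ‖∑ n ∈ Finset.range k, a n • e (P n) + ∑ n ∈ Finset.range d, a (k + n) • e (T + n)‖
        ≤ η / 2 * u := by
    intro P hP T hT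
    have hQ : StrictMono (fun n => if n < k then P n else T + (n - k)) := by
      apply strictMono_nat_of_lt_succ
      intro n
      have h1 : P n < P (n + 1) := hP (Nat.lt_succ_self n)
      by_cases h : n + 1 < k
      · have h' : n < k := by omega
        simp [h, h', h1]
      · by_cases h' : n < k
        · have : n + 1 = k := by omega
          subst this
          simp only [h', if_true, h, if_false]
          omega
        · simp only [h', h, if_false]
          omega
    have h1 := he.norm_sum_range (k + d) a hQ
    rw [Finset.sum_range_add] at h1
    rw [← h1] at hsmall
    convert hsmall using 3
    · apply Finset.sum_congr rfl
      intro n hn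
      simp [Finset.mem_range.1 hn]
    · apply Finset.sum_congr rfl
      intro n hn
      simp
  refine ⟨k, fun n => u⁻¹ * a n, ?_, ?_⟩
  · simp only [mul_smul, ← Finset.smul_sum]
    rw [norm_smul, ← hu, Real.norm_of_nonneg (by positivity)]
    field_simp
  · intro P hP
    simp only [mul_smul, ← Finset.smul_sum]
    rw [← smul_sub, norm_smul, Real.norm_of_nonneg (by positivity)]
    -- `P k + k` lies beyond both `P k` and `k`, so one tail serves `P` and the identity.
    have h1 := key P hP (P k + k) (by omega)
    have h2 := key id strictMono_id (P k + k) (by simp)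
    simp only [id] at h2
    have h3 := (norm_sub_le _ _).trans (add_le_add h1 h2)
    rw [add_sub_add_right_eq_sub] at h3
    rw [inv_mul_le_iff₀ hupos]
    linarith

theorem norm_sum_range_shift_sub_le {E : Type*} [SeminormedAddCommGroup E] {e : ℕ → E} {b : ℝ} (hb : ∀ n, ‖e n‖ ≤ b) (R n : ℕ) :
    ‖∑ r ∈ Finset.range R, e (n + r) - ∑ r ∈ Finset.range R, e r‖ ≤ 2 * n * b := by
  induction n with
  | zero => simp
  | succ n ih =>
    have h : ∑ r ∈ Finset.range R, e (n + 1 + r) - ∑ r ∈ Finset.range R, e (n + r)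
        = e (n + R) - e n := by
      rw [← Finset.sum_sub_distrib]
      have := Finset.sum_range_sub (fun r => e (n + r)) R
      simp only [add_zero] at this
      rw [← this]
      apply Finset.sum_congr rfl
      intro r _
      rw [show n + 1 + r = n + (r + 1) by ring]
    have h2 : ‖e (n + R) - e n‖ ≤ 2 * b := by
      have := (norm_sub_le _ _).trans (add_le_add (hb (n + R)) (hb n))
      linarith
    rw [← h] at h2
    have h3 := norm_add_le (∑ r ∈ Finset.range R, e (n + 1 + r) - ∑ r ∈ Finset.range R, e (n + r))
      (∑ r ∈ Finset.range R, e (n + r) - ∑ r ∈ Finset.range R, e r)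
    rw [sub_add_sub_cancel] at h3
    push_cast
    linarith

/-- A mean of shifted terms differs from the unshifted mean only by boundary terms, negligible for
large `R`. -/
theorem norm_mean_translates_sub_le {e : ℕ → E} {b : ℝ} (hb : ∀ n, ‖e n‖ ≤ b)
    (k : ℕ) (a : ℕ → ℝ) {R : ℕ} :
    ‖cesaroMean (fun r => ∑ n ∈ Finset.range k, a n • e (n + r)) R
      - (∑ n ∈ Finset.range k, a n) • cesaroMean e R‖
      ≤ (R : ℝ)⁻¹ * ∑ n ∈ Finset.range k, |a n| * (2 * n * b) := by
  have h : cesaroMean (fun r => ∑ n ∈ Finset.range k, a n • e (n + r)) R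
      - (∑ n ∈ Finset.range k, a n) • cesaroMean e R
      = (R : ℝ)⁻¹ • ∑ n ∈ Finset.range k, a n •
        (∑ r ∈ Finset.range R, e (n + r) - ∑ r ∈ Finset.range R, e r) := by
    unfold cesaroMean
    rw [Finset.sum_comm, smul_comm, ← smul_sub, Finset.sum_smul, ← Finset.sum_sub_distrib]
    simp only [smul_sub, ← Finset.smul_sum]
  rw [h, norm_smul, Real.norm_of_nonneg (by positivity)]
  apply mul_le_mul_of_nonneg_left _ (by positivity)
  apply (norm_sum_le _ _).trans
  apply Finset.sum_le_sum
  intro n _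
  rw [norm_smul, Real.norm_eq_abs]
  exact mul_le_mul_of_nonneg_left (norm_sum_range_shift_sub_le hb R n) (abs_nonneg _)

theorem norm_cesaroMean_sub_le {f : ℕ → E} {y : E} {c : ℝ} {n : ℕ} (hn : 0 < n)
    (h : ∀ i, ‖f i - y‖ ≤ c) : ‖cesaroMean f n - y‖ ≤ c := by
  have hn' : (0 : ℝ) < n := by exact_mod_cast hn
  have : cesaroMean f n - y = (n : ℝ)⁻¹ • ∑ i ∈ Finset.range n, (f i - y) := by
    unfold cesaroMean
    rw [Finset.sum_sub_distrib, smul_sub, Finset.sum_const, Finset.card_range,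
      ← Nat.cast_smul_eq_nsmul ℝ, smul_smul, inv_mul_cancel₀ hn'.ne', one_smul]
  rw [this, norm_smul, Real.norm_of_nonneg (by positivity), inv_mul_le_iff₀ hn']
  apply (norm_sum_le _ _).trans
  apply (Finset.sum_le_sum (fun i _ => h i)).trans
  simp

/-- The means of the subsequences of a singular sequence are uniformly Cauchy. -/
theorem IsSingularSeq.cauchy_cesaroMean {e : ℕ → E} (he : IsSingularSeq e) {ε : ℝ} (hε : 0 < ε) :
    ∃ R₀ : ℕ, 0 < R₀ ∧ ∀ R R' : ℕ, R₀ ≤ R → R₀ ≤ R' → ∀ P Q : ℕ → ℕ, StrictMono P → StrictMono Q →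
      ‖cesaroMean (fun i => e (P i)) R - cesaroMean (fun i => e (Q i)) R'‖ ≤ ε := by
  obtain ⟨hs, -, hnb⟩ := he
  set b := ‖e 0‖ with hb
  have hb0 : 0 ≤ b := norm_nonneg _
  set η := min (1 / 4) (ε / (8 * (b + 1))) with hη
  have hηpos : 0 < η := by positivity
  obtain ⟨k, a, hu, hinv⟩ := hs.exists_almost_invariant hnb hηpos
  set u := ∑ n ∈ Finset.range k, a n • e n with hudef
  set A := ∑ n ∈ Finset.range k, a n with hA
  set S := ∑ n ∈ Finset.range k, |a n| * (2 * n * b) with hS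
  have hS0 : 0 ≤ S := Finset.sum_nonneg (fun n _ => by positivity)
  obtain ⟨R₀, hR₀⟩ := exists_nat_gt (max 1 (S / η))
  have hR₀1 : (1 : ℝ) < R₀ := lt_of_le_of_lt (le_max_left _ _) hR₀
  have key : ∀ R : ℕ, R₀ ≤ R → ∀ P : ℕ → ℕ, StrictMono P →
      ‖A • cesaroMean (fun i => e (P i)) R - u‖ ≤ 2 * η := by
    intro R hR P hP
    have hRR : (R₀ : ℝ) ≤ R := by exact_mod_cast hR
    have hR0 : (0 : ℝ) < R := by linarith
    have h1 := norm_mean_translates_sub_le (e := fun i => e (P i)) (b := b)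
      (fun n => (hs.norm_eq _).le) k a (R := R)
    have h2 : ‖cesaroMean (fun r => ∑ n ∈ Finset.range k, a n • e (P (n + r))) R - u‖ ≤ η := by
      apply norm_cesaroMean_sub_le (by exact_mod_cast hR0)
      intro r
      exact hinv (fun n => P (n + r)) (fun i j h => hP (by omega))
    have h3 : (R : ℝ)⁻¹ * S ≤ η := by
      rw [inv_mul_le_iff₀ hR0]
      have : S / η < R := lt_of_le_of_lt (le_max_right _ _) (hR₀.trans_le hRR)
      rw [div_lt_iff₀ hηpos] at this
      exact this.le
    have h4 := norm_sub_le (cesaroMean (fun r => ∑ n ∈ Finset.range k, a n • e (P (n + r))) R - u)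
      (cesaroMean (fun r => ∑ n ∈ Finset.range k, a n • e (P (n + r))) R
        - A • cesaroMean (fun i => e (P i)) R)
    rw [sub_sub_sub_cancel_left] at h4
    linarith
  have hηq : η ≤ 1 / 4 := min_le_left _ _
  have hA1 : 1 / 2 ≤ |A| * b := by
    have h1 := key R₀ le_rfl id strictMono_id
    have hR0 : 0 < R₀ := by exact_mod_cast (zero_lt_one.trans hR₀1)
    have h2 : ‖cesaroMean (fun i => e (id i)) R₀‖ ≤ b := by
      have := norm_cesaroMean_sub_le (f := fun i => e (id i)) (y := 0) (c := b) hR0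
        (fun i => by simpa using (hs.norm_eq i).le)
      simpa using this
    have h3 : 1 ≤ 2 * η + |A| * b := by
      rw [← hu]
      have h4 := norm_sub_norm_le u (A • cesaroMean (fun i => e (id i)) R₀)
      rw [norm_sub_rev] at h4
      have h5 : ‖A • cesaroMean (fun i => e (id i)) R₀‖ ≤ |A| * b := by
        rw [norm_smul, Real.norm_eq_abs]
        exact mul_le_mul_of_nonneg_left h2 (abs_nonneg _)
      linarith
    linarith
  refine ⟨R₀, by exact_mod_cast (zero_lt_one.trans hR₀1), ?_⟩
  intro R R' hR hR' P Q hP hQ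
  have h1 := (norm_sub_le _ _).trans (add_le_add (key R hR P hP) (key R' hR' Q hQ))
  rw [sub_sub_sub_cancel_right, ← smul_sub, norm_smul, Real.norm_eq_abs] at h1
  set D := ‖cesaroMean (fun i => e (P i)) R - cesaroMean (fun i => e (Q i)) R'‖
  have hD : 0 ≤ D := norm_nonneg _
  have h2 : 1 / 2 * D ≤ b * (4 * η) := by
    calc 1 / 2 * D ≤ (|A| * b) * D := mul_le_mul_of_nonneg_right hA1 hD
      _ = b * (|A| * D) := by ring
      _ ≤ b * (4 * η) := mul_le_mul_of_nonneg_left (by linarith) hb0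
  have h3 : b * (8 * η) ≤ ε := by
    have h4 : η ≤ ε / (8 * (b + 1)) := min_le_right _ _
    rw [le_div_iff₀ (by positivity)] at h4
    nlinarith
  linarith

end Sequences

/-! ### The weak limit and the natural decomposition -/

section Limits

variable {G : Type v} [NormedAddCommGroup G] [NormedSpace ℝ G]

/-- The means of all subsequences converge to `y`, uniformly. -/
def HasUniformMean (e : ℕ → G) (y : G) : Prop :=
  ∀ ε : ℝ, 0 < ε → ∃ R₀ : ℕ, 0 < R₀ ∧ ∀ R : ℕ, R₀ ≤ R → ∀ P : ℕ → ℕ, StrictMono P →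
    ‖cesaroMean (fun i => e (P i)) R - y‖ ≤ ε

theorem IsSingularSeq.exists_hasUniformMean [CompleteSpace G] {e : ℕ → G} (he : IsSingularSeq e) :
    ∃ y, HasUniformMean e y := by
  have hc : CauchySeq (cesaroMean e) := by
    rw [Metric.cauchySeq_iff']
    intro ε hε
    obtain ⟨R₀, h0, hR⟩ := he.cauchy_cesaroMean (half_pos hε)
    refine ⟨R₀, fun n hn => ?_⟩
    rw [dist_eq_norm]
    exact (hR n R₀ hn le_rfl id id strictMono_id strictMono_id).trans_lt (half_lt_self hε)
  obtain ⟨y, hy⟩ := cauchySeq_tendsto_of_complete hc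
  refine ⟨y, fun ε hε => ?_⟩
  obtain ⟨R₀, h0, hR⟩ := he.cauchy_cesaroMean hε
  refine ⟨R₀, h0, fun R hRR P hP => ?_⟩
  have h1 : Tendsto (fun n => ‖cesaroMean (fun i => e (P i)) R - cesaroMean e n‖) atTop
      (𝓝 ‖cesaroMean (fun i => e (P i)) R - y‖) := (tendsto_const_nhds.sub hy).norm
  apply le_of_tendsto h1
  filter_upwards [eventually_ge_atTop R₀] with n hn
  exact hR R n hRR hn P id hP strictMono_id

theorem HasUniformMean.tendsto {e : ℕ → G} {y : G} (h : HasUniformMean e y) {P : ℕ → ℕ}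
    (hP : StrictMono P) : Tendsto (cesaroMean (fun i => e (P i))) atTop (𝓝 y) := by
  rw [Metric.tendsto_atTop]
  intro ε hε
  obtain ⟨R₀, _, hR⟩ := h (ε / 2) (half_pos hε)
  refine ⟨R₀, fun n hn => ?_⟩
  rw [dist_eq_norm]
  exact (hR n hn P hP).trans_lt (half_lt_self hε)

theorem map_cesaroMean (f : G →L[ℝ] ℝ) (e : ℕ → G) (n : ℕ) :
    f (cesaroMean e n) = cesaroMean (fun i => f (e i)) n := by
  simp [cesaroMean, map_sum]

theorem le_cesaroMean {r : ℕ → ℝ} {c : ℝ} (h : ∀ i, c ≤ r i) {n : ℕ} (hn : 0 < n) :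
    c ≤ cesaroMean r n := by
  have hn' : (0 : ℝ) < n := by exact_mod_cast hn
  unfold cesaroMean
  rw [smul_eq_mul, le_inv_mul_iff₀ hn']
  have := Finset.card_nsmul_le_sum (Finset.range n) r c (fun i _ => h i)
  simpa using this

/-- Otherwise some subsequence has all its means at level at least `c` under `f`, although they too
converge to `y`. -/
theorem HasUniformMean.eventually_lt {e : ℕ → G} {y : G} (h : HasUniformMean e y)
    (f : G →L[ℝ] ℝ) {c : ℝ} (hc : f y < c) : ∀ᶠ n in atTop, f (e n) < c := by
  by_contra hcon
  rw [not_eventually] at hcon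
  obtain ⟨P, hP, hPc⟩ := extraction_of_frequently_atTop hcon
  have h1 := (f.continuous.tendsto y).comp (h.tendsto hP)
  have h2 : c ≤ f y := by
    apply ge_of_tendsto h1
    filter_upwards [eventually_gt_atTop 0] with n hn
    simp only [Function.comp, map_cesaroMean]
    exact le_cesaroMean (fun i => not_lt.1 (hPc i)) hn
  linarith

theorem HasUniformMean.weak_tendsto {e : ℕ → G} {y : G} (h : HasUniformMean e y)
    (f : G →L[ℝ] ℝ) : Tendsto (fun n => f (e n)) atTop (𝓝 (f y)) := by
  rw [tendsto_order]
  refine ⟨fun c hc => ?_, fun c hc => h.eventually_lt f hc⟩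
  have := h.eventually_lt (-f) (c := -c) (by simpa using hc)
  filter_upwards [this] with n hn
  simpa using hn

theorem HasUniformMean.eq_of_weak_tendsto {e : ℕ → G} {y y' : G} (h : HasUniformMean e y)
    (h' : ∀ f : G →L[ℝ] ℝ, Tendsto (fun n => f (e n)) atTop (𝓝 (f y'))) : y = y' := by
  by_contra hne
  obtain ⟨f, hf⟩ := SeparatingDual.exists_separating_of_ne (R := ℝ) hne
  exact hf (tendsto_nhds_unique (h.weak_tendsto f) (h' f))

/-- With `y` replaced by the mean of the next `p` terms, both sides are norms of combinations of `e`
with the same coefficients, hence equal; then `p` tends to infinity. -/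
theorem HasUniformMean.norm_sum_sub {e : ℕ → G} {y : G} (h : HasUniformMean e y)
    (he : IsSpreadingSeq e) (n : ℕ) (a : ℕ → ℝ) {P : ℕ → ℕ} (hP : StrictMono P) :
    ‖∑ j ∈ Finset.range n, a j • (e (P j) - y)‖ = ‖∑ j ∈ Finset.range n, a j • (e j - y)‖ := by
  set A := ∑ j ∈ Finset.range n, a j
  have key : ∀ Q : ℕ → ℕ, StrictMono Q → Tendsto (fun p : ℕ =>
      ‖∑ j ∈ Finset.range (n + p), (if j < n then a j else - A * (p : ℝ)⁻¹) • e (Q j)‖) atTop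
      (𝓝 ‖∑ j ∈ Finset.range n, a j • (e (Q j) - y)‖) := by
    intro Q hQ
    have h1 : ∀ p : ℕ,
        ∑ j ∈ Finset.range (n + p), (if j < n then a j else - A * (p : ℝ)⁻¹) • e (Q j)
        = ∑ j ∈ Finset.range n, a j • e (Q j) - A • cesaroMean (fun i => e (Q (n + i))) p := by
      intro p
      rw [Finset.sum_range_add, sub_eq_add_neg]
      congr 1
      · apply Finset.sum_congr rfl
        intro j hj
        simp [Finset.mem_range.1 hj]
      · simp [cesaroMean, ← Finset.smul_sum, mul_smul]
    have h2 : ∑ j ∈ Finset.range n, a j • (e (Q j) - y)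
        = ∑ j ∈ Finset.range n, a j • e (Q j) - A • y := by
      simp only [smul_sub, Finset.sum_sub_distrib, A, Finset.sum_smul]
    simp only [h1, h2]
    apply Tendsto.norm
    apply tendsto_const_nhds.sub
    exact (h.tendsto (P := fun i => Q (n + i)) (fun i j hij => hQ (by omega))).const_smul A
  apply tendsto_nhds_unique (key P hP)
  have h := key id strictMono_id
  simp only [id] at h
  convert h using 2
  exact he.norm_sum_range _ _ hP

/-- Moving only the last index of a vanishing combination gives another vanishing one; their
difference is a multiple of `f n - f (n + 1)`, so the last coefficient is zero. -/
theorem linearIndependent_of_norm_sum_range {f : ℕ → G}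
    (hs : ∀ (n : ℕ) (a : ℕ → ℝ) (P : ℕ → ℕ), StrictMono P →
      ‖∑ j ∈ Finset.range n, a j • f (P j)‖ = ‖∑ j ∈ Finset.range n, a j • f j‖)
    (hn : ∀ n, f n ≠ f (n + 1)) : LinearIndependent ℝ f := by
  have key : ∀ (n : ℕ) (a : ℕ → ℝ), ∑ j ∈ Finset.range n, a j • f j = 0 → ∀ j < n, a j = 0 := by
    intro n
    induction n with
    | zero => intro a _ j hj; omega
    | succ n ih =>
      intro a ha
      have hP : StrictMono (fun j => if j < n then j else j + 1) := by
        intro i j hij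
        simp only
        split_ifs <;> omega
      have h1 := hs (n + 1) a _ hP
      rw [ha, norm_zero, norm_eq_zero] at h1
      have h2 := ha.trans h1.symm
      rw [Finset.sum_range_succ, Finset.sum_range_succ] at h2
      have h3 : ∑ j ∈ Finset.range n, a j • f (if j < n then j else j + 1)
          = ∑ j ∈ Finset.range n, a j • f j := by
        apply Finset.sum_congr rfl
        intro j hj
        simp [Finset.mem_range.1 hj]
      rw [h3, add_right_inj] at h2
      simp only [lt_irrefl, if_false] at h2
      have h4 : a n = 0 := by
        by_contra h
        exact hn n (smul_right_injective G h h2)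
      rw [Finset.sum_range_succ, h4, zero_smul, add_zero] at ha
      intro j hj
      rcases Nat.lt_succ_iff_lt_or_eq.1 hj with h | rfl
      · exact ih a ha j h
      · exact h4
  rw [linearIndependent_iff']
  intro s g hg i hi
  have h := key (s.sup id + 1) (fun j => if j ∈ s then g j else 0) (by
    rw [← hg]
    refine (Finset.sum_subset_zero_on_sdiff ?_ ?_ ?_).symm
    · intro j hj
      exact Finset.mem_range.2 (Nat.lt_succ_of_le (Finset.le_sup (f := id) hj))
    · intro j hj
      simp [(Finset.mem_sdiff.1 hj).2]
    · intro j hj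
      simp [hj]) i (Nat.lt_succ_of_le (Finset.le_sup (f := id) hi))
  simpa [hi] using h

theorem IsSpreadingSeq.ne_succ {e : ℕ → G} (he : IsSpreadingSeq e) (ht : ¬ IsTrivialSeq e) (n : ℕ) :
    e n ≠ e (n + 1) := by
  intro h
  apply ht
  have h0 : ∀ P : ℕ → ℕ, StrictMono P → ‖e (P 0) - e (P 1)‖ = ‖e 0 - e 1‖ := by
    intro P hP
    have := he.norm_sum_range 2 (fun j => if j = 0 then 1 else -1) hP
    simpa [Finset.sum_range_succ, ← sub_eq_add_neg] using this
  have h1 : ‖e 0 - e 1‖ = 0 := by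
    rw [← h0 (fun j => n + j) (fun i j hij => by simpa using hij)]
    simpa [sub_eq_zero] using h
  have h2 : ∀ i j, i < j → ‖e i - e j‖ = 0 := by
    intro i j hij
    rw [← h1, ← h0 (fun m => if m = 0 then i else j + m - 1)]
    · simp
    · apply strictMono_nat_of_lt_succ
      intro m
      rcases Nat.eq_zero_or_pos m with rfl | hm
      · simpa using hij
      · simp [hm.ne']; omega
  intro i j
  rcases lt_trichotomy i j with hij | rfl | hij
  · exact h2 i j hij
  · simp
  · rw [norm_sub_rev]; exact h2 j i hij

end Limits

/-! ### Enumerations of finite and infinite sets -/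

section Enumeration

theorem card_toFinset_ofPred (A : Finset ℕ) (h : (Set.ofPred (· ∈ A)).Finite) :
    h.toFinset.card = A.card := by
  congr 1
  ext a
  simp

theorem Finset.nth_mem_of_lt_card {A : Finset ℕ} {k : ℕ} (hk : k < A.card) :
    Nat.nth (· ∈ A) k ∈ A :=
  Nat.nth_mem (p := (· ∈ A)) k (fun hf => by rwa [card_toFinset_ofPred])

theorem nth_image_range {B : ℕ → ℕ} (hB : StrictMono B) {c k : ℕ} (hk : k < c) :
    Nat.nth (· ∈ (Finset.range c).image B) k = B k := by
  have h : Nat.count (· ∈ (Finset.range c).image B) (B k) = k := by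
    rw [Nat.count_eq_card_filter_range]
    have : (Finset.range (B k)).filter (· ∈ (Finset.range c).image B)
        = (Finset.range k).image B := by
      ext a
      simp only [Finset.mem_filter, Finset.mem_range, Finset.mem_image]
      constructor
      · rintro ⟨h1, i, h2, rfl⟩
        exact ⟨i, hB.lt_iff_lt.1 h1, rfl⟩
      · rintro ⟨i, h1, rfl⟩
        exact ⟨hB h1, i, h1.trans hk, rfl⟩
    rw [this, Finset.card_image_of_injective _ hB.injective, Finset.card_range]
  have h2 := Nat.nth_count (p := (· ∈ (Finset.range c).image B)) (n := B k)
    (Finset.mem_image_of_mem B (Finset.mem_range.2 hk))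
  rwa [h] at h2

theorem card_image_range {B : ℕ → ℕ} (hB : StrictMono B) (c : ℕ) :
    ((Finset.range c).image B).card = c := by
  rw [Finset.card_image_of_injective _ hB.injective, Finset.card_range]

theorem Set.Infinite.nth_strictMono {N : Set ℕ} (hN : N.Infinite) :
    StrictMono (Nat.nth (· ∈ N)) :=
  Nat.nth_strictMono (p := (· ∈ N)) hN

theorem Set.Infinite.nth_mem {N : Set ℕ} (hN : N.Infinite) (k : ℕ) : Nat.nth (· ∈ N) k ∈ N :=
  Nat.nth_mem_of_infinite (p := (· ∈ N)) hN k

theorem exists_nth_eq_of_mem {N : Set ℕ} {a : ℕ} (ha : a ∈ N) :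
    ∃ k, Nat.nth (· ∈ N) k = a := by
  obtain ⟨k, _, h⟩ := Nat.exists_lt_card_nth_eq (p := (· ∈ N)) ha
  exact ⟨k, h⟩

theorem nth_le_nth_of_subset {N L : Set ℕ} (hN : N.Infinite) (hNL : N ⊆ L) (k : ℕ) :
    Nat.nth (· ∈ L) k ≤ Nat.nth (· ∈ N) k := by
  have hL : L.Infinite := hN.mono hNL
  have h : ∀ k, ∃ i, Nat.nth (· ∈ L) i = Nat.nth (· ∈ N) k :=
    fun k => exists_nth_eq_of_mem (hNL (hN.nth_mem k))
  choose i hi using h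
  have hmono : StrictMono i := by
    intro a b hab
    rw [← hL.nth_strictMono.lt_iff_lt, hi, hi]
    exact hN.nth_strictMono hab
  rw [← hi]
  exact hL.nth_strictMono.monotone (hmono.id_le k)

theorem nth_mem_range {B : ℕ → ℕ} (hB : StrictMono B) (k : ℕ) :
    Nat.nth (· ∈ Set.range B) k = B k := by
  have hinf : (Set.range B).Infinite := Set.infinite_range_of_injective hB.injective
  have h1 : ∀ k, B k ≤ Nat.nth (· ∈ Set.range B) k := by
    have h : ∀ k, ∃ i, B i = Nat.nth (· ∈ Set.range B) k := fun k => hinf.nth_mem k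
    choose i hi using h
    have hmono : StrictMono i := by
      intro a b hab
      rw [← hB.lt_iff_lt, hi, hi]
      exact hinf.nth_strictMono hab
    intro k
    rw [← hi]
    exact hB.monotone (hmono.id_le k)
  have h2 : ∀ k, ∃ i, Nat.nth (· ∈ Set.range B) i = B k :=
    fun k => exists_nth_eq_of_mem ⟨k, rfl⟩
  choose i hi using h2
  have hmono : StrictMono i := by
    intro a b hab
    rw [← hinf.nth_strictMono.lt_iff_lt, hi, hi]
    exact hB hab
  apply le_antisymm _ (h1 k)
  rw [← hi]
  exact hinf.nth_strictMono.monotone (hmono.id_le k)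

end Enumeration

/-! ### Sets all of whose infinite subsets begin with a member of `F` -/

section VeryLarge

/-- Every infinite subset of `M` has an initial segment in `F`. -/
def IsVeryLarge (F : Set (Finset ℕ)) (M : Set ℕ) : Prop :=
  ∀ B : ℕ → ℕ, StrictMono B → (∀ m, B m ∈ M) → ∃ c, (Finset.range c).image B ∈ F

/-- Otherwise the limit of the initial segments, an infinite set, would belong to the closed family
of finite sets. -/
theorem IsCompactFamily.exists_notMem {R : Set (Finset ℕ)} (hR : IsCompactFamily R) {B : ℕ → ℕ}
    (hB : StrictMono B) : ∃ c, (Finset.range c).image B ∉ R := by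
  classical
  by_contra! hcon
  have hlim : Tendsto (fun c => fun n => decide (n ∈ (Finset.range c).image B)) atTop
      (𝓝 (fun n => decide (n ∈ Set.range B))) := by
    rw [tendsto_pi_nhds]
    intro n
    apply tendsto_const_nhds.congr'
    filter_upwards [eventually_gt_atTop n] with c hc
    rw [decide_eq_decide]
    simp only [Set.mem_range, Finset.mem_image, Finset.mem_range]
    constructor
    · rintro ⟨i, rfl⟩
      exact ⟨i, (hB.id_le i).trans_lt hc, rfl⟩
    · rintro ⟨i, _, rfl⟩
      exact ⟨i, rfl⟩
  obtain ⟨s, _, hs⟩ := hR.mem_of_tendsto hlim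
    (Eventually.of_forall fun c => ⟨_, hcon c, rfl⟩)
  have hinf : (Set.range B).Infinite := Set.infinite_range_of_injective hB.injective
  apply hinf
  have : Set.range B = s := by
    ext n
    have := congrFun hs n
    rwa [decide_eq_decide] at this
  rw [this]
  exact s.finite_toSet

theorem exists_insert_mem_initialClosure {F : Set (Finset ℕ)}
    (hF : IsHereditaryFamily (initialClosure F)) {t : Finset ℕ} (ht : t ∈ initialClosure F)
    (htF : t ∉ F) : ∃ n, (∀ a ∈ t, a < n) ∧ insert n t ∈ initialClosure F := by
  obtain ⟨s, hs, hts⟩ := ht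
  have hne : t ≠ s := by rintro rfl; exact htF hs
  obtain ⟨n, hn, hnt⟩ := Finset.exists_of_ssubset (hts.1.ssubset_of_ne hne)
  refine ⟨n, fun a ha => ?_, ?_⟩
  · by_contra h
    exact hnt (hts.2 n hn a ha (not_lt.1 h))
  · exact hF s ⟨s, hs, subset_rfl, fun a ha _ _ _ => ha⟩ _
      (Finset.insert_subset hn hts.1)

/-- `g t` is a number by which a non-maximal `t` can be extended in the closure, and `μ` grows
faster than `g`. By spreading, any later term of `μ` extends `t` as well. A sequence that never met
`F` would thus keep all its initial segments in the closure, against compactness. -/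
theorem IsRegularThin.exists_isVeryLarge {F : Set (Finset ℕ)} (hF : IsRegularThin F)
    (hne : F.Nonempty) {M : Set ℕ} (hM : M.Infinite) :
    ∃ μ : ℕ → ℕ, StrictMono μ ∧ (∀ i, μ i ∈ M) ∧ IsVeryLarge F (Set.range μ) := by
  classical
  obtain ⟨-, hcomp, hher, hspr⟩ := hF
  have hg : ∀ t : Finset ℕ, ∃ n, t ∈ initialClosure F → t ∉ F →
      (∀ a ∈ t, a < n) ∧ insert n t ∈ initialClosure F := by
    intro t
    by_cases h : t ∈ initialClosure F ∧ t ∉ F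
    · obtain ⟨n, hn⟩ := exists_insert_mem_initialClosure hher h.1 h.2
      exact ⟨n, fun _ _ => hn⟩
    · exact ⟨0, fun h1 h2 => absurd ⟨h1, h2⟩ h⟩
  choose g hg using hg
  set G : ℕ → ℕ := fun p => (Finset.range p).powerset.sup g with hG
  have hgG : ∀ (t : Finset ℕ) p, (∀ a ∈ t, a < p) → g t ≤ G p := fun t p h =>
    Finset.le_sup (f := g) (Finset.mem_powerset.2 fun a ha => Finset.mem_range.2 (h a ha))
  have hnext : ∀ p : ℕ, ∃ m ∈ M, G p ≤ m ∧ p ≤ m := fun p => by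
    obtain ⟨m, hm, h⟩ := hM.exists_gt (max (G p) p)
    exact ⟨m, hm, (le_max_left _ _).trans h.le, (le_max_right _ _).trans h.le⟩
  choose ν hνM hνG hν using hnext
  set μ : ℕ → ℕ := fun i => Nat.rec (ν 0) (fun _ m => ν (m + 1)) i with hμ
  have hμs : ∀ i, μ (i + 1) = ν (μ i + 1) := fun i => rfl
  have hmono : StrictMono μ := strictMono_nat_of_lt_succ fun i => by
    rw [hμs]
    exact hν (μ i + 1)
  have hμM : ∀ i, μ i ∈ M := by
    intro i
    cases i with
    | zero => exact hνM 0
    | succ i => rw [hμs]; exact hνM _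
  refine ⟨μ, hmono, hμM, ?_⟩
  intro B hB hBM
  by_contra! hcon
  have hbound : ∀ c, g ((Finset.range c).image B) ≤ B c := by
    intro c
    obtain ⟨i, hi⟩ := hBM c
    rw [← hi]
    cases i with
    | zero =>
      have : c = 0 := by
        by_contra h
        obtain ⟨j, hj⟩ := hBM 0
        have := hB (Nat.pos_of_ne_zero h)
        rw [← hi, ← hj, hmono.lt_iff_lt] at this
        omega
      subst this
      exact (hgG _ 0 (by simp)).trans (hνG 0)
    | succ i =>
      rw [hμs]
      refine (hgG _ _ ?_).trans (hνG _)
      intro a ha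
      obtain ⟨j, hj, rfl⟩ := Finset.mem_image.1 ha
      obtain ⟨i', hi'⟩ := hBM j
      have := hB (Finset.mem_range.1 hj)
      rw [← hi, ← hi'] at this
      replace this := (hmono.lt_iff_lt (a := i') (b := i + 1)).1 this
      rw [← hi', Nat.lt_succ_iff]
      exact hmono.monotone (Nat.lt_succ_iff.1 this)
  obtain ⟨c, hc⟩ := hcomp.exists_notMem hB
  apply hc
  clear hc
  induction c with
  | zero =>
    obtain ⟨s, hs⟩ := hne
    exact ⟨s, hs, by simp [IsInitialSegment]⟩
  | succ c ih =>
    obtain ⟨h1, h2⟩ := hg _ ih (hcon c)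
    set n := g ((Finset.range c).image B) with hn
    have hlt : ∀ i < c, B i < n := fun i hi =>
      h1 _ (Finset.mem_image_of_mem B (Finset.mem_range.2 hi))
    have h3 := hspr (c + 1) (fun i => if (i : ℕ) < c then B i else n) (fun i => B i)
      (by
        intro i j hij
        have h4 : (i : ℕ) < j := hij
        have h5 := j.2
        have h6 : (i : ℕ) < c := by omega
        simp only [h6, if_true]
        split_ifs
        · exact hB h4
        · exact hlt _ h6)
      (fun i j hij => hB hij)
      (by
        intro i
        have h5 := i.2
        split_ifs with h
        · exact le_rfl
        · have : (i : ℕ) = c := by omega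
          rw [this]
          exact hbound c)
      (by
        convert h2 using 1
        ext a
        simp only [Finset.mem_image, Finset.mem_univ, true_and, Finset.mem_insert,
          Finset.mem_range]
        constructor
        · rintro ⟨i, rfl⟩
          split_ifs with h
          · exact Or.inr ⟨i, h, rfl⟩
          · exact Or.inl rfl
        · rintro (rfl | ⟨i, hi, rfl⟩)
          · exact ⟨Fin.last c, by simp⟩
          · exact ⟨⟨i, by omega⟩, by simp [hi]⟩)
    convert h3 using 1
    ext a
    simp only [Finset.mem_image, Finset.mem_univ, true_and, Finset.mem_range]
    constructor
    · rintro ⟨i, hi, rfl⟩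
      exact ⟨⟨i, hi⟩, rfl⟩
    · rintro ⟨i, rfl⟩
      exact ⟨i, i.2, rfl⟩

theorem IsThinFamily.nonempty_of_mem {F : Set (Finset ℕ)} (hF : IsThinFamily F)
    (hne : ∃ s ∈ F, s.Nonempty) {t : Finset ℕ} (ht : t ∈ F) : t.Nonempty := by
  rw [Finset.nonempty_iff_ne_empty]
  rintro rfl
  obtain ⟨s, hs, h⟩ := hne
  have := hF ∅ ht s hs (by simp [IsInitialSegment])
  simp [← this] at h

end VeryLarge

/-! ### Concatenation of plegma families -/

section Plegma

/-- `s(k) < t(k)` whenever both elements exist. -/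
def Precedes (s t : Finset ℕ) : Prop :=
  ∀ k, k < s.card → k < t.card → Nat.nth (· ∈ s) k < Nat.nth (· ∈ t) k

/-- `s(k) < t(k+1)` whenever both elements exist. -/
def Interlaced (s t : Finset ℕ) : Prop :=
  ∀ k, k < s.card → k + 1 < t.card → Nat.nth (· ∈ s) k < Nat.nth (· ∈ t) (k + 1)

/-- The first `n` terms of a sequence of finite sets form a plegma family. -/
def IsPlegmaUpTo (n : ℕ) (S : ℕ → Finset ℕ) : Prop :=
  (∀ i < n, (S i).Nonempty) ∧ (∀ i j, i < j → j < n → Precedes (S i) (S j)) ∧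
    ∀ i < n, ∀ j < n, Interlaced (S i) (S j)

theorem IsPlegmaUpTo.isPlegma {n : ℕ} {S : ℕ → Finset ℕ} (h : IsPlegmaUpTo n S) :
    IsPlegma (fun j : Fin n => S j) :=
  ⟨fun i => h.1 i i.2, fun i j hij => h.2.1 i j hij j.2, fun i j => h.2.2 i i.2 j j.2⟩

theorem IsPlegma.isPlegmaUpTo {n : ℕ} {S : ℕ → Finset ℕ} (h : IsPlegma (fun j : Fin n => S j)) :
    IsPlegmaUpTo n S :=
  ⟨fun i hi => h.1 ⟨i, hi⟩, fun i j hij hj => h.2.1 ⟨i, hij.trans hj⟩ ⟨j, hj⟩ hij,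
    fun i hi j hj => h.2.2 ⟨i, hi⟩ ⟨j, hj⟩⟩

/-- The relations that have to hold between the members of two plegma families for their
concatenation to be a plegma family. -/
def Concatenable (s t : Finset ℕ) : Prop :=
  Precedes s t ∧ Interlaced s t ∧ Interlaced t s

theorem IsPlegmaUpTo.append {p q : ℕ} {S T : ℕ → Finset ℕ} (hS : IsPlegmaUpTo p S)
    (hT : IsPlegmaUpTo q T) (hST : ∀ i < p, ∀ j < q, Concatenable (S i) (T j)) :
    IsPlegmaUpTo (p + q) (fun i => if i < p then S i else T (i - p)) := by
  refine ⟨fun i hi => ?_, fun i j hij hj => ?_, fun i hi j hj => ?_⟩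
  · simp only
    split_ifs with h
    · exact hS.1 i h
    · exact hT.1 _ (by omega)
  · simp only
    split_ifs with h1 h2 h2
    · exact hS.2.1 i j hij h2
    · exact (hST i h1 _ (by omega)).1
    · omega
    · exact hT.2.1 _ _ (by omega) (by omega)
  · simp only
    split_ifs with h1 h2 h2
    · exact hS.2.2 i h1 j h2
    · exact (hST i h1 _ (by omega)).2.1
    · exact (hST j h2 _ (by omega)).2.2
    · exact hT.2.2 _ (by omega) _ (by omega)

end Plegma

/-! ### Slots that follow a given plegma family -/

section Guide

/-- A plegma family inside the range of `ℓ` is followed slot by slot by an increasing sequence of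
slots which is eventually consecutive. -/
theorem IsPlegmaUpTo.exists_guide {n : ℕ} (hn : 0 < n) {S : ℕ → Finset ℕ} (hS : IsPlegmaUpTo n S)
    {ℓ : ℕ → ℕ} (hℓ : StrictMono ℓ) (hSℓ : ∀ j < n, ∀ a ∈ S j, a ∈ Set.range ℓ) :
    ∃ h : ℕ → ℕ, StrictMono h ∧ (∃ K, ∀ m ≥ K, h (m + 1) = h m + 1) ∧
      (∀ j < n, ∀ m < (S j).card, Nat.nth (· ∈ S j) m ≤ ℓ (h m)) ∧
      ∀ j < n, ∀ m, m + 1 < (S j).card → ℓ (h m + 1) ≤ Nat.nth (· ∈ S j) (m + 1) := by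
  have hidx : ∀ j m, ∃ i, j < n → m < (S j).card → ℓ i = Nat.nth (· ∈ S j) m := by
    intro j m
    by_cases hj : j < n ∧ m < (S j).card
    · obtain ⟨i, hi⟩ := hSℓ j hj.1 _ (Finset.nth_mem_of_lt_card hj.2)
      exact ⟨i, fun _ _ => hi⟩
    · exact ⟨0, fun h1 h2 => absurd ⟨h1, h2⟩ hj⟩
  choose i hi using hidx
  have hlt : ∀ j < n, ∀ j' < n, ∀ m, m < (S j).card → m + 1 < (S j').card →
      i j m < i j' (m + 1) := by
    intro j hj j' hj' m hm hm'
    rw [← hℓ.lt_iff_lt, hi j m hj hm, hi j' _ hj' hm']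
    exact hS.2.2 j hj j' hj' m hm hm'
  have hadd : ∀ j < n, ∀ d m, m + d < (S j).card → i j m + d ≤ i j (m + d) := by
    intro j hj d
    induction d with
    | zero => intro m _; exact le_rfl
    | succ d ih =>
      intro m hm
      have h1 := ih m (by omega)
      have h2 := hlt j hj j hj (m + d) (by omega) (by omega)
      rw [show m + (d + 1) = m + d + 1 by ring]
      omega
  -- `H m` is the maximum of the indices met up to step `m`, each advanced by one per step since it
  -- was met. The advance makes `H` strictly increasing when some members are exhausted, and
  -- consecutive when all are.
  set f : ℕ → ℕ × ℕ → ℕ := fun m p => if p.2 < (S p.1).card then i p.1 p.2 + (m - p.2) else 0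
    with hf
  set H : ℕ → ℕ := fun m => (Finset.range n ×ˢ Finset.range (m + 1)).sup (f m) with hH
  have hle : ∀ m, ∀ j < n, ∀ m' ≤ m, m' < (S j).card → i j m' + (m - m') ≤ H m := by
    intro m j hj m' hm' hc
    have h1 := Finset.le_sup (f := f m) (s := Finset.range n ×ˢ Finset.range (m + 1))
      (b := (j, m')) (by simp only [Finset.mem_product, Finset.mem_range]; omega)
    simpa [hf, hc] using h1
  have hne : ∀ j < n, 0 < (S j).card := fun j hj => Finset.card_pos.2 (hS.1 j hj)
  have hatt : ∀ m, ∃ j < n, ∃ m' ≤ m, m' < (S j).card ∧ H m ≤ i j m' + (m - m') := by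
    intro m
    obtain ⟨⟨j, m'⟩, hp, he⟩ := Finset.exists_mem_eq_sup
      (Finset.range n ×ˢ Finset.range (m + 1))
      ⟨(0, 0), by simp only [Finset.mem_product, Finset.mem_range]; omega⟩ (f m)
    simp only [Finset.mem_product, Finset.mem_range] at hp
    change H m = f m (j, m') at he
    by_cases hc : m' < (S j).card
    · refine ⟨j, hp.1, m', by omega, hc, ?_⟩
      rw [he]
      simp [hf, hc]
    · refine ⟨0, hn, 0, by omega, hne 0 hn, ?_⟩
      rw [he]
      simp [hf, hc]
  have hmono : StrictMono H := strictMono_nat_of_lt_succ fun m => by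
    obtain ⟨j, hj, m', hm', hc, h⟩ := hatt m
    have := hle (m + 1) j hj m' (by omega) hc
    omega
  refine ⟨H, hmono, ⟨(Finset.range n).sup fun j => (S j).card, fun m hm => ?_⟩, ?_, ?_⟩
  · apply le_antisymm _ (hmono (Nat.lt_succ_self m))
    obtain ⟨j, hj, m', hm', hc, h⟩ := hatt (m + 1)
    have h1 : (S j).card ≤ (Finset.range n).sup fun j => (S j).card :=
      Finset.le_sup (f := fun j => (S j).card) (Finset.mem_range.2 hj)
    have := hle m j hj m' (by omega) hc
    omega
  · intro j hj m hm
    rw [← hi j m hj hm]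
    apply hℓ.monotone
    have := hle m j hj m le_rfl hm
    omega
  · intro j hj m hm
    rw [← hi j _ hj hm]
    apply hℓ.monotone
    -- From where the maximum is attained, interlacing gives a larger index for `S j` at `m' + 1`,
    -- and each further element gains at least one.
    obtain ⟨j', hj', m', hm', hc, h⟩ := hatt m
    have h1 := hlt j' hj' j hj m' hc (by omega)
    have h2 := hadd j hj (m - m') (m' + 1) (by omega)
    rw [show m' + 1 + (m - m') = m + 1 by omega] at h2
    omega

end Guide

/-! ### Plegma families along sequences of slots -/

/-- A sequence `μ` cut into slots which begin at the terms `μ (S p)`.  The `p`-th slot has room for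
`p + 1` consecutive blocks of length `ν p`; `seg` cuts sequences to members of `F`. -/
structure SlotScheme (F : Set (Finset ℕ)) where
  μ : ℕ → ℕ
  ν : ℕ → ℕ
  S : ℕ → ℕ
  seg : (ℕ → ℕ) → F
  μ_mono : StrictMono μ
  ν_mono : Monotone ν
  S_step : ∀ p, S p + (p + 1) * ν p < S (p + 1)
  seg_spec : ∀ B : ℕ → ℕ, StrictMono B → (∀ m, B m ∈ Set.range μ) →
    ∃ c, 0 < c ∧ (seg B : Finset ℕ) = (Finset.range c).image B

namespace SlotScheme

variable {F : Set (Finset ℕ)} (A : SlotScheme F)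

/-- The first element of a slot. -/
def mark (p : ℕ) : ℕ := A.μ (A.S p)

/-- The `j`-th sequence with elements in the slots `h 0 < h 1 < ⋯`. -/
def pos (h : ℕ → ℕ) (j m : ℕ) : ℕ := A.μ (A.S (h m) + 1 + (h m - h 0) * A.ν (h m) + j)

/-- The initial segment in `F` of the `j`-th sequence along `h`. -/
def path (h : ℕ → ℕ) (j : ℕ) : F := A.seg (A.pos h j)

theorem S_mono : StrictMono A.S :=
  strictMono_nat_of_lt_succ fun p => lt_of_le_of_lt (Nat.le_add_right _ _) (A.S_step p)

theorem mark_mono : StrictMono A.mark := A.μ_mono.comp A.S_mono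

variable {A} {h : ℕ → ℕ}

theorem mark_lt_pos (j m : ℕ) : A.mark (h m) < A.pos h j m :=
  A.μ_mono (by omega)

/-- The block number `h m - h 0` is at most `h m`, and slot `p` has blocks `0, …, p`. -/
theorem pos_lt_mark (hh : StrictMono h) {j : ℕ} (hj : j < A.ν (h 0)) (m : ℕ) :
    A.pos h j m < A.mark (h m + 1) := by
  apply A.μ_mono
  refine lt_of_le_of_lt ?_ (A.S_step (h m))
  have h1 : A.ν (h 0) ≤ A.ν (h m) := A.ν_mono (hh.monotone (Nat.zero_le m))
  have h2 : (h m - h 0) * A.ν (h m) ≤ h m * A.ν (h m) := Nat.mul_le_mul_right _ (Nat.sub_le _ _)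
  rw [Nat.add_mul, one_mul]
  omega

theorem pos_lt_pos_succ (hh : StrictMono h) {j : ℕ} (hj : j < A.ν (h 0)) (j' m : ℕ) :
    A.pos h j m < A.pos h j' (m + 1) :=
  (pos_lt_mark hh hj m).trans_le ((A.mark_mono.monotone (hh (Nat.lt_succ_self m))).trans
    (mark_lt_pos j' (m + 1)).le)

theorem pos_strictMono (hh : StrictMono h) {j : ℕ} (hj : j < A.ν (h 0)) :
    StrictMono (A.pos h j) :=
  strictMono_nat_of_lt_succ fun m => pos_lt_pos_succ hh hj j m

theorem pos_lt_pos {j j' : ℕ} (hj : j < j') (m : ℕ) : A.pos h j m < A.pos h j' m :=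
  A.μ_mono (by omega)

/-- Both elements lie in slot `h (m + 1)`, but the shifted path uses the earlier block `h (m + 1) -
h 1`. This is why `pos` counts blocks from `h 0`. -/
theorem pos_shift_lt_pos (hh : StrictMono h) {j' : ℕ} (hj' : j' < A.ν (h 1)) (j m : ℕ) :
    A.pos (fun n => h (n + 1)) j' m < A.pos h j (m + 1) := by
  apply A.μ_mono
  simp only [zero_add]
  have h1 : A.ν (h 1) ≤ A.ν (h (m + 1)) := A.ν_mono (hh.monotone (by omega))
  have h2 : h 0 < h 1 := hh one_pos
  have h3 : h 1 ≤ h (m + 1) := hh.monotone (by omega)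
  have h4 : (h (m + 1) - h 1 + 1) * A.ν (h (m + 1)) ≤ (h (m + 1) - h 0) * A.ν (h (m + 1)) :=
    Nat.mul_le_mul_right _ (by omega)
  rw [Nat.add_mul, one_mul] at h4
  omega

theorem pos_mem_range (j m : ℕ) : A.pos h j m ∈ Set.range A.μ := ⟨_, rfl⟩

theorem path_eq (hh : StrictMono h) {j : ℕ} (hj : j < A.ν (h 0)) :
    ∃ c, 0 < c ∧ (A.path h j : Finset ℕ) = (Finset.range c).image (A.pos h j) :=
  A.seg_spec _ (pos_strictMono hh hj) fun m => pos_mem_range j m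

theorem path_nonempty (hh : StrictMono h) {j : ℕ} (hj : j < A.ν (h 0)) :
    (A.path h j : Finset ℕ).Nonempty := by
  obtain ⟨c, hc, h⟩ := path_eq hh hj
  rw [h]
  exact (Finset.nonempty_range_iff.2 hc.ne').image _

theorem nth_path (hh : StrictMono h) {j : ℕ} (hj : j < A.ν (h 0)) {k : ℕ}
    (hk : k < (A.path h j : Finset ℕ).card) :
    Nat.nth (· ∈ (A.path h j : Finset ℕ)) k = A.pos h j k := by
  obtain ⟨c, hc, h⟩ := path_eq hh hj
  rw [h, card_image_range (pos_strictMono hh hj)] at hk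
  rw [h]
  exact nth_image_range (pos_strictMono hh hj) hk

theorem mem_range_of_mem_path (hh : StrictMono h) {j : ℕ} (hj : j < A.ν (h 0)) {a : ℕ}
    (ha : a ∈ (A.path h j : Finset ℕ)) : a ∈ Set.range A.μ := by
  obtain ⟨c, hc, h⟩ := path_eq hh hj
  rw [h] at ha
  obtain ⟨m, -, rfl⟩ := Finset.mem_image.1 ha
  exact pos_mem_range j m

theorem mark_le_of_mem_path (hh : StrictMono h) {j : ℕ} (hj : j < A.ν (h 0)) {a : ℕ}
    (ha : a ∈ (A.path h j : Finset ℕ)) : A.mark (h 0) ≤ a := by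
  obtain ⟨c, hc, h'⟩ := path_eq hh hj
  rw [h'] at ha
  obtain ⟨m, -, rfl⟩ := Finset.mem_image.1 ha
  exact (A.mark_mono.monotone (hh.monotone (Nat.zero_le m))).trans (mark_lt_pos j m).le

theorem isPlegmaUpTo_path (hh : StrictMono h) {q : ℕ} (hq : q ≤ A.ν (h 0)) :
    IsPlegmaUpTo q (fun j => (A.path h j : Finset ℕ)) := by
  refine ⟨fun i hi => path_nonempty hh (by omega), fun i j hij hj k hk hk' => ?_,
    fun i hi j hj k hk hk' => ?_⟩
  · rw [nth_path hh (by omega) hk, nth_path hh (by omega) hk']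
    exact pos_lt_pos hij k
  · rw [nth_path hh (by omega) hk, nth_path hh (by omega) hk']
    exact pos_lt_pos_succ hh (by omega) j k

theorem concatenable_path_shift (hh : StrictMono h) {i j : ℕ} (hi : i < A.ν (h 0))
    (hj : j < A.ν (h 1)) :
    Concatenable (A.path h i : Finset ℕ) (A.path (fun n => h (n + 1)) j : Finset ℕ) := by
  have hh' : StrictMono (fun n => h (n + 1)) := fun a b hab => hh (by omega)
  refine ⟨fun k hk hk' => ?_, fun k hk hk' => ?_, fun k hk hk' => ?_⟩
  · rw [nth_path hh hi hk, nth_path hh' hj hk']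
    exact (pos_lt_mark hh hi k).trans_le ((A.mark_mono.monotone (hh (Nat.lt_succ_self k))).trans
      (mark_lt_pos (h := fun n => h (n + 1)) j k).le)
  · rw [nth_path hh hi hk, nth_path hh' hj hk']
    exact (pos_lt_mark hh hi k).trans_le ((A.mark_mono.monotone (hh (by omega))).trans
      (mark_lt_pos (h := fun n => h (n + 1)) j (k + 1)).le)
  · rw [nth_path hh hi hk', nth_path hh' hj hk]
    exact pos_shift_lt_pos hh hj i k

theorem concatenable_path_of_guide (hh : StrictMono h) {s : Finset ℕ}
    (h1 : ∀ m < s.card, Nat.nth (· ∈ s) m ≤ A.mark (h m))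
    (h2 : ∀ m, m + 1 < s.card → A.mark (h m + 1) ≤ Nat.nth (· ∈ s) (m + 1)) {j : ℕ}
    (hj : j < A.ν (h 0)) : Concatenable s (A.path h j : Finset ℕ) := by
  refine ⟨fun k hk hk' => ?_, fun k hk hk' => ?_, fun k hk hk' => ?_⟩
  · rw [nth_path hh hj hk']
    exact (h1 k hk).trans_lt (mark_lt_pos j k)
  · rw [nth_path hh hj hk']
    exact (h1 k hk).trans_lt ((mark_lt_pos j k).trans (pos_lt_pos_succ hh hj j k))
  · rw [nth_path hh hj hk]
    exact (pos_lt_mark hh hj k).trans_le (h2 k hk')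

end SlotScheme

/-! ### Means of `x` along slots, their limit, and the main estimate -/

namespace SlotScheme

variable {F : Set (Finset ℕ)} (A : SlotScheme F) {X : Type u} [NormedAddCommGroup X]
  [NormedSpace ℝ X] {G : Type v} [NormedAddCommGroup G] [NormedSpace ℝ G]

/-- Combinations of `x` along plegma families that begin after the `i`-th mark, and are not too long,
have up to `2⁻ⁱ` the norm of the same combinations of `e`. -/
def Approximates (x : F → X) (e : ℕ → G) : Prop :=
  ∀ (i p q : ℕ) (c d : ℕ → ℝ) (S T : ℕ → F), 0 < p → p + q ≤ i + 1 + A.ν i + A.ν (i + 1) →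
    (∀ j < p, |c j| ≤ 1) → (∀ j < q, |d j| ≤ 1) →
    IsPlegmaUpTo p (fun j => (S j : Finset ℕ)) → IsPlegmaUpTo q (fun j => (T j : Finset ℕ)) →
    (∀ i < p, ∀ j < q, Concatenable (S i : Finset ℕ) (T j : Finset ℕ)) →
    (∀ j < p, ∀ a ∈ (S j : Finset ℕ), a ∈ Set.range A.μ) →
    (∀ j < q, ∀ a ∈ (T j : Finset ℕ), a ∈ Set.range A.μ) →
    (∀ a ∈ (S 0 : Finset ℕ), A.mark i ≤ a) →
    |‖∑ j ∈ Finset.range p, c j • x (S j) + ∑ j ∈ Finset.range q, d j • x (T j)‖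
      - ‖∑ j ∈ Finset.range p, c j • e j + ∑ j ∈ Finset.range q, d j • e (p + j)‖| ≤ (1 / 2) ^ i

/-- The means of `e` of length at least `ν i` are up to `2⁻ⁱ` equal to `y`. -/
def HasMeans (e : ℕ → G) (y : G) : Prop :=
  ∀ i R, A.ν i ≤ R → ∀ P : ℕ → ℕ, StrictMono P →
    ‖cesaroMean (fun j => e (P j)) R - y‖ ≤ (1 / 2) ^ i

/-- The mean of `x` over the plegma family of length `ν q` along `h`. -/
noncomputable def pathMean (x : F → X) (h : ℕ → ℕ) (q : ℕ) : X :=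
  cesaroMean (fun j => x (A.path h j)) (A.ν q)

variable {A} {x : F → X} {e : ℕ → G} {y : G}

theorem abs_inv_ν_le (hν : ∀ i, i + 1 ≤ A.ν i) (i : ℕ) : |((A.ν i : ℕ) : ℝ)⁻¹| ≤ 1 := by
  have h1 : (1 : ℝ) ≤ A.ν i := by exact_mod_cast le_trans (Nat.le_add_left 1 i) (hν i)
  rw [abs_of_nonneg (by positivity)]
  exact inv_le_one_of_one_le₀ h1

/-- The difference is a combination along one concatenated plegma family, hence comparable to a
difference of two means of `e`, each close to `y`. -/
theorem norm_pathMean_sub_le (hx : A.Approximates x e) (he : A.HasMeans e y)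
    (hν : ∀ i, i + 1 ≤ A.ν i) {h : ℕ → ℕ} (hh : StrictMono h) {q q' : ℕ} (hq : q ≤ h 0)
    (hq' : q' ≤ h 0 + 1) :
    ‖A.pathMean x h q - A.pathMean x (fun n => h (n + 1)) q'‖
      ≤ (1 / 2) ^ q + (1 / 2) ^ q' + (1 / 2) ^ (h 0) := by
  have hh' : StrictMono (fun n => h (n + 1)) := fun a b hab => hh (by omega)
  have h01 : h 0 + 1 ≤ h 1 := hh one_pos
  have hp1 : A.ν q ≤ A.ν (h 0) := A.ν_mono hq
  have hp2 : A.ν q' ≤ A.ν (h 0 + 1) := A.ν_mono hq'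
  have hp3 : A.ν q' ≤ A.ν (h 1) := A.ν_mono (hq'.trans h01)
  have h0 := hν q
  have key := hx (h 0) (A.ν q) (A.ν q') (fun _ => (A.ν q : ℝ)⁻¹) (fun _ => -(A.ν q' : ℝ)⁻¹)
    (A.path h) (A.path fun n => h (n + 1)) (by omega) (by omega)
    (fun _ _ => abs_inv_ν_le hν q) (fun _ _ => by rw [abs_neg]; exact abs_inv_ν_le hν q')
    (isPlegmaUpTo_path hh hp1) (isPlegmaUpTo_path hh' hp3)
    (fun i hi j hj => concatenable_path_shift hh (by omega) (by omega))
    (fun j hj a ha => mem_range_of_mem_path hh (by omega) ha)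
    (fun j hj a ha => mem_range_of_mem_path hh' (hj.trans_le hp3) ha)
    (fun a ha => mark_le_of_mem_path hh (by omega) ha)
  simp only [← Finset.smul_sum] at key
  simp only [neg_smul, ← sub_eq_add_neg] at key
  have h1 := he q (A.ν q) le_rfl id strictMono_id
  have h2 := he q' (A.ν q') le_rfl (fun j => A.ν q + j) (fun i j hij => by simpa using hij)
  have h3 := (norm_sub_le _ _).trans (add_le_add h1 h2)
  rw [sub_sub_sub_cancel_right] at h3
  have h4 := (abs_le.1 key).2
  simp only [cesaroMean, id, pathMean] at h3 ⊢
  linarith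

theorem consecutive_strictMono (i : ℕ) : StrictMono (fun m => i + m) := fun a b h => by
  simpa using h

theorem dist_pathMean_consecutive_le (hx : A.Approximates x e) (he : A.HasMeans e y)
    (hν : ∀ i, i + 1 ≤ A.ν i) (i : ℕ) :
    dist (A.pathMean x (fun m => i + m) i) (A.pathMean x (fun m => i + 1 + m) (i + 1))
      ≤ 5 / 2 * (1 / 2) ^ i := by
  have h := norm_pathMean_sub_le hx he hν (consecutive_strictMono i) (q := i) (q' := i + 1)
    (by simp) (by simp)
  simp only [add_zero, ← add_assoc, add_right_comm i _ 1] at h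
  rw [dist_eq_norm]
  apply h.trans_eq
  ring

theorem exists_limit_pathMean [CompleteSpace X] (hx : A.Approximates x e) (he : A.HasMeans e y)
    (hν : ∀ i, i + 1 ≤ A.ν i) :
    ∃ z, ∀ i, ‖A.pathMean x (fun m => i + m) i - z‖ ≤ 5 * (1 / 2) ^ i := by
  have hd := dist_pathMean_consecutive_le hx he hν
  obtain ⟨z, hz⟩ := cauchySeq_tendsto_of_complete
    (cauchySeq_of_le_geometric (1 / 2) (5 / 2) (by norm_num) hd)
  refine ⟨z, fun i => ?_⟩
  have := dist_le_of_le_geometric_of_tendsto (1 / 2) (5 / 2) (by norm_num) hd hz i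
  rw [dist_eq_norm] at this
  apply this.trans_eq
  ring

theorem half_pow_le {i j : ℕ} (h : i ≤ j) : ((1 : ℝ) / 2) ^ j ≤ (1 / 2) ^ i :=
  pow_le_pow_of_le_one (by norm_num) (by norm_num) h

/-- Each shift of `h` lowers `K` by one and raises the precision to `q + 1`. The constant 5
reproduces itself, as `5 = 5 / 2 + 5 / 2`. -/
theorem norm_pathMean_sub_limit_le (hx : A.Approximates x e) (he : A.HasMeans e y)
    (hν : ∀ i, i + 1 ≤ A.ν i) {z : X}
    (hz : ∀ i, ‖A.pathMean x (fun m => i + m) i - z‖ ≤ 5 * (1 / 2) ^ i) (K : ℕ) :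
    ∀ (h : ℕ → ℕ), StrictMono h → (∀ m ≥ K, h (m + 1) = h m + 1) → ∀ q ≤ h 0,
      ‖A.pathMean x h q - z‖ ≤ 5 * (1 / 2) ^ q := by
  induction K with
  | zero =>
    intro h hh hK q hq
    have heq : (fun n => h (n + 1)) = fun m => h 0 + 1 + m := by
      funext m
      induction m with
      | zero => exact hK 0 le_rfl
      | succ m ih => rw [hK (m + 1) (Nat.zero_le _), ih]; ring
    have h1 := norm_pathMean_sub_le hx he hν hh hq (q' := h 0 + 1) le_rfl
    rw [heq] at h1
    have h2 := hz (h 0 + 1)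
    have h3 := norm_sub_le_norm_sub_add_norm_sub (A.pathMean x h q)
      (A.pathMean x (fun m => h 0 + 1 + m) (h 0 + 1)) z
    have h4 := half_pow_le hq
    rw [pow_succ] at h1 h2
    linarith
  | succ K ih =>
    intro h hh hK q hq
    have h01 : h 0 + 1 ≤ h 1 := hh one_pos
    have h1 := norm_pathMean_sub_le hx he hν hh hq (q' := q + 1) (by omega)
    have h2 := ih (fun n => h (n + 1)) (fun a b hab => hh (by omega))
      (fun m hm => hK (m + 1) (by omega)) (q + 1) (by simp only [zero_add]; omega)
    have h3 := norm_sub_le_norm_sub_add_norm_sub (A.pathMean x h q)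
      (A.pathMean x (fun n => h (n + 1)) (q + 1)) z
    have h4 := half_pow_le hq
    rw [pow_succ] at h1 h2
    linarith

theorem norm_limit_eq (hx : A.Approximates x e) (he : A.HasMeans e y)
    (hν : ∀ i, i + 1 ≤ A.ν i) {z : X}
    (hz : ∀ i, ‖A.pathMean x (fun m => i + m) i - z‖ ≤ 5 * (1 / 2) ^ i) : ‖z‖ = ‖y‖ := by
  -- 7 = 5 + 1 + 1: from `z` to the mean of `x`, to the mean of `e`, to `y`.
  have hb : ∀ i : ℕ, |‖z‖ - ‖y‖| ≤ 7 * (1 / 2) ^ i := by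
    intro i
    have h0 := hν i
    have hh := consecutive_strictMono i
    have key := hx i (A.ν i) 0 (fun _ => (A.ν i : ℝ)⁻¹) (fun _ => 0)
      (A.path fun m => i + m) (A.path fun m => i + m) (by omega) (by omega)
      (fun _ _ => abs_inv_ν_le hν i) (fun _ _ => by simp)
      (isPlegmaUpTo_path hh (by simp)) (isPlegmaUpTo_path hh (by simp))
      (fun i hi j hj => by omega)
      (fun j hj a ha => mem_range_of_mem_path hh (by simpa using hj) ha)
      (fun j hj a ha => by omega)
      (fun a ha => by simpa using mark_le_of_mem_path hh (by simp; omega) ha)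
    simp only [Finset.range_zero, Finset.sum_empty, add_zero] at key
    simp only [← Finset.smul_sum] at key
    have h1 := he i (A.ν i) le_rfl id strictMono_id
    have h2 := (abs_norm_sub_norm_le _ _).trans h1
    have h3 := (abs_norm_sub_norm_le _ _).trans (hz i)
    simp only [cesaroMean, id, pathMean] at h2 h3
    rw [abs_le] at key h2 h3 ⊢
    constructor <;> linarith [key.1, key.2, h2.1, h2.2, h3.1, h3.2]
  have hlim : Tendsto (fun i : ℕ => 7 * ((1 : ℝ) / 2) ^ i) atTop (𝓝 (7 * 0)) :=
    (tendsto_pow_atTop_nhds_zero_of_lt_one (by norm_num) (by norm_num)).const_mul 7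
  have h := ge_of_tendsto' hlim hb
  rw [mul_zero] at h
  exact sub_eq_zero.1 (abs_eq_zero.1 (le_antisymm h (abs_nonneg _)))

theorem abs_norm_sum_sub_le (hx : A.Approximates x e) (he : A.HasMeans e y)
    (hν : ∀ i, i + 1 ≤ A.ν i) {z : X}
    (hz : ∀ i, ‖A.pathMean x (fun m => i + m) i - z‖ ≤ 5 * (1 / 2) ^ i) {l n : ℕ} (hn : 0 < n)
    (hnl : n ≤ l + 1) {a : ℕ → ℝ} (ha : ∀ j < n, |a j| ≤ 1) {S : ℕ → F}
    (hS : IsPlegmaUpTo n (fun j => (S j : Finset ℕ)))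
    (hSL : ∀ j < n, ∀ b ∈ (S j : Finset ℕ), b ∈ Set.range A.mark)
    (hSl : ∀ b ∈ (S 0 : Finset ℕ), A.mark l ≤ b) :
    |‖∑ j ∈ Finset.range n, a j • (x (S j) - z)‖ - ‖∑ j ∈ Finset.range n, a j • (e j - y)‖|
      ≤ (6 * (l + 1) + 1) * (1 / 2) ^ l := by
  obtain ⟨h, hh, ⟨K, hK⟩, hle, hge⟩ := hS.exists_guide hn A.mark_mono hSL
  have hS0 : 0 < (S 0 : Finset ℕ).card := Finset.card_pos.2 (hS.1 0 hn)
  have hl : l ≤ h 0 := by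
    rw [← A.mark_mono.le_iff_le]
    exact (hSl _ (Finset.nth_mem_of_lt_card hS0)).trans (hle 0 hn 0 hS0)
  have hνl : A.ν l ≤ A.ν (h 0) := A.ν_mono hl
  set s := ∑ j ∈ Finset.range n, a j with hs
  have hsl : |s| ≤ l + 1 := by
    calc |s| ≤ ∑ j ∈ Finset.range n, |a j| := Finset.abs_sum_le_sum_abs _ _
      _ ≤ ∑ j ∈ Finset.range n, 1 := Finset.sum_le_sum fun j hj => ha j (Finset.mem_range.1 hj)
      _ = n := by simp
      _ ≤ l + 1 := by exact_mod_cast hnl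
  have hνpos : (l + 1 : ℝ) ≤ A.ν l := by exact_mod_cast hν l
  -- The condition `l + 1 ≤ ν l` keeps the appended coefficients in the admissible range.
  have hd : |-(s * (A.ν l : ℝ)⁻¹)| ≤ 1 := by
    rw [abs_neg, abs_mul, abs_of_nonneg (a := (A.ν l : ℝ)⁻¹) (by positivity), ← div_eq_mul_inv,
      div_le_one (by linarith [Nat.cast_nonneg (α := ℝ) l])]
    linarith
  have key := hx l n (A.ν l) a (fun _ => -(s * (A.ν l : ℝ)⁻¹)) S (A.path h) hn (by omega) ha
    (fun _ _ => hd) hS (isPlegmaUpTo_path hh hνl)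
    (fun i hi j hj => concatenable_path_of_guide hh (hle i hi) (hge i hi) (by omega))
    (fun j hj b hb => by
      obtain ⟨p, hp⟩ := hSL j hj b hb
      exact ⟨A.S p, hp⟩)
    (fun j hj b hb => mem_range_of_mem_path hh (by omega) hb) hSl
  simp only [← Finset.smul_sum] at key
  simp only [neg_smul, mul_smul, ← sub_eq_add_neg] at key
  have h1 := norm_pathMean_sub_limit_le hx he hν hz K h hh hK l hl
  have h2 := he l (A.ν l) le_rfl (fun j => n + j) (consecutive_strictMono n)
  simp only [pathMean, cesaroMean] at h1 h2
  have e1 : ∑ j ∈ Finset.range n, a j • (x (S j) - z)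
      = ∑ j ∈ Finset.range n, a j • x (S j) - s • z := by
    simp only [smul_sub, Finset.sum_sub_distrib, hs, Finset.sum_smul]
  have e2 : ∑ j ∈ Finset.range n, a j • (e j - y)
      = ∑ j ∈ Finset.range n, a j • e j - s • y := by
    simp only [smul_sub, Finset.sum_sub_distrib, hs, Finset.sum_smul]
  have b1 : |‖∑ j ∈ Finset.range n, a j • x (S j) - s • z‖
      - ‖∑ j ∈ Finset.range n, a j • x (S j)
        - s • (A.ν l : ℝ)⁻¹ • ∑ j ∈ Finset.range (A.ν l), x (A.path h j)‖|
      ≤ (l + 1) * (5 * (1 / 2) ^ l) := by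
    apply (abs_norm_sub_norm_le _ _).trans
    rw [sub_sub_sub_cancel_left, ← smul_sub, norm_smul, Real.norm_eq_abs]
    exact mul_le_mul hsl h1 (norm_nonneg _) (by positivity)
  have b2 : |‖∑ j ∈ Finset.range n, a j • e j - s • y‖
      - ‖∑ j ∈ Finset.range n, a j • e j
        - s • (A.ν l : ℝ)⁻¹ • ∑ j ∈ Finset.range (A.ν l), e (n + j)‖|
      ≤ (l + 1) * (1 / 2) ^ l := by
    apply (abs_norm_sub_norm_le _ _).trans
    rw [sub_sub_sub_cancel_left, ← smul_sub, norm_smul, Real.norm_eq_abs]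
    exact mul_le_mul hsl h2 (norm_nonneg _) (by positivity)
  rw [e1, e2]
  have e3 : ((6 : ℝ) * (l + 1) + 1) * (1 / 2) ^ l
      = (l + 1) * (5 * (1 / 2) ^ l) + (l + 1) * (1 / 2) ^ l + (1 / 2) ^ l := by ring
  rw [e3]
  rw [abs_le] at key b1 b2 ⊢
  constructor <;> linarith [key.1, key.2, b1.1, b1.2, b2.1, b2.2]

end SlotScheme

/-! ### Existence of plegma families and uniqueness of spreading models -/

theorem IsVeryLarge.mono {F : Set (Finset ℕ)} {M N : Set ℕ} (h : IsVeryLarge F M) (hNM : N ⊆ M) :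
    IsVeryLarge F N := fun B hB hBN => h B hB fun m => hNM (hBN m)

theorem IsVeryLarge.exists_isPlegmaUpTo {F : Set (Finset ℕ)} {N : Set ℕ} (hN : N.Infinite)
    (h : IsVeryLarge F N) (hne : ∀ t ∈ F, t.Nonempty) (l n : ℕ) :
    ∃ S : ℕ → F, IsPlegmaUpTo n (fun j => (S j : Finset ℕ)) ∧
      ∀ j, ∀ a ∈ (S j : Finset ℕ), a ∈ N ∧ Nat.nth (· ∈ N) l ≤ a := by
  -- Residue classes modulo `n + 1` of the enumeration of `N` interlace as a plegma family requires.
  set B : ℕ → ℕ → ℕ := fun j m => Nat.nth (· ∈ N) (l + m * (n + 1) + j) with hB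
  have hlt : ∀ {j m j' m' : ℕ}, l + m * (n + 1) + j < l + m' * (n + 1) + j' → B j m < B j' m' :=
    fun h => hN.nth_strictMono h
  have hmono : ∀ j, StrictMono (B j) := fun j => strictMono_nat_of_lt_succ fun m => hlt (by
    rw [Nat.add_mul m 1, one_mul]; omega)
  have hex : ∀ j, ∃ c, (Finset.range c).image (B j) ∈ F := fun j =>
    h (B j) (hmono j) fun m => hN.nth_mem _
  choose c hc using hex
  refine ⟨fun j => ⟨_, hc j⟩, ⟨fun i _ => hne _ (hc i), fun i j hij hj k hk hk' => ?_,
    fun i hi j hj k hk hk' => ?_⟩, fun j a ha => ?_⟩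
  · rw [card_image_range (hmono _)] at hk hk'
    rw [nth_image_range (hmono _) hk, nth_image_range (hmono _) hk']
    exact hlt (by omega)
  · rw [card_image_range (hmono _)] at hk hk'
    rw [nth_image_range (hmono _) hk, nth_image_range (hmono _) hk']
    exact hlt (by rw [Nat.add_mul k 1, one_mul]; omega)
  · obtain ⟨m, -, rfl⟩ := Finset.mem_image.1 ha
    exact ⟨hN.nth_mem _, hN.nth_strictMono.monotone (by rw [add_assoc]; exact Nat.le_add_right _ _)⟩

section Generation

variable {X : Type u} [SeminormedAddCommGroup X] [NormedSpace ℝ X]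
  {E : Type v} [SeminormedAddCommGroup E] [NormedSpace ℝ E]
  {H : Type w} [SeminormedAddCommGroup H] [NormedSpace ℝ H]
  {F : Set (Finset ℕ)} {x : F → X} {M : Set ℕ} {e : ℕ → E}

/-- The estimate in the definition of spreading models, for families indexed by `ℕ`. -/
def SpreadingModelEstimate (x : F → X) (M : Set ℕ) (e : ℕ → E) (δ : ℕ → ℝ) : Prop :=
  ∀ (l n : ℕ), 0 < n → n ≤ l + 1 → ∀ a : ℕ → ℝ, (∀ j < n, |a j| ≤ 1) →
    ∀ S : ℕ → F, IsPlegmaUpTo n (fun j => (S j : Finset ℕ)) →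
      (∀ j < n, ∀ b ∈ (S j : Finset ℕ), b ∈ M) →
      (∀ b ∈ (S 0 : Finset ℕ), Nat.nth (· ∈ M) l ≤ b) →
      |‖∑ j ∈ Finset.range n, a j • x (S j)‖ - ‖∑ j ∈ Finset.range n, a j • e j‖| ≤ δ l

theorem generatesSpreadingModel_iff : GeneratesSpreadingModel x M e ↔ LinearIndependent ℝ e ∧
    ∃ δ : ℕ → ℝ, (∀ l, 0 < δ l) ∧ Tendsto δ atTop (𝓝 0) ∧ SpreadingModelEstimate x M e δ := by
  refine and_congr_right fun _ => exists_congr fun δ => and_congr_right fun _ =>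
    and_congr_right fun _ => ⟨fun h l n hn hnl a ha S hS hSM hSl => ?_,
      fun h l k hkl a ha s hs hsM hsl => ?_⟩
  · obtain ⟨k, rfl⟩ := Nat.exists_eq_succ_of_ne_zero hn.ne'
    rw [Finset.sum_range, Finset.sum_range]
    exact h l k (by omega) (fun j => a j) (fun j => abs_le.1 (ha j j.2)) (fun j => S j)
      hS.isPlegma (fun j => hSM j j.2) hSl
  -- Families over `Fin (k + 1)` extend to `ℕ` by wrapping indices around.
  · have hcast : ∀ j : Fin (k + 1), Fin.ofNat (k + 1) (j : ℕ) = j := fun j => by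
      ext; simp [Fin.ofNat, Nat.mod_eq_of_lt j.2]
    have := h l (k + 1) (by omega) (by omega) (fun j => a (Fin.ofNat (k + 1) j))
      (fun j _ => abs_le.2 (ha _)) (fun j => s (Fin.ofNat (k + 1) j))
      (IsPlegma.isPlegmaUpTo (by simpa only [hcast] using hs)) (fun j _ => hsM _)
      (by simpa using hsl)
    rw [Finset.sum_range, Finset.sum_range] at this
    simpa only [hcast] using this

theorem SpreadingModelEstimate.mono {δ : ℕ → ℝ} (h : SpreadingModelEstimate x M e δ) {N : Set ℕ}
    (hN : N.Infinite) (hNM : N ⊆ M) : SpreadingModelEstimate x N e δ :=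
  fun l n hn hnl a ha S hS hSN hSl => h l n hn hnl a ha S hS (fun j hj b hb => hNM (hSN j hj b hb))
    fun b hb => (nth_le_nth_of_subset hN hNM l).trans (hSl b hb)

theorem GeneratesSpreadingModel.mono (h : GeneratesSpreadingModel x M e) {N : Set ℕ}
    (hN : N.Infinite) (hNM : N ⊆ M) : GeneratesSpreadingModel x N e := by
  rw [generatesSpreadingModel_iff] at h ⊢
  obtain ⟨hli, δ, h0, h1, h2⟩ := h
  exact ⟨hli, δ, h0, h1, h2.mono hN hNM⟩

/-- Both sequences approximate the norms of the same vectors of `X`, along plegma families that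
exist arbitrarily far out. -/
theorem GeneratesSpreadingModel.isIsometricSeq {f : ℕ → H} (he : GeneratesSpreadingModel x M e)
    (hf : GeneratesSpreadingModel x M f) (hM : M.Infinite) (hlarge : IsVeryLarge F M)
    (hne : ∀ t ∈ F, t.Nonempty) : IsIsometricSeq e f := by
  rw [generatesSpreadingModel_iff] at he hf
  obtain ⟨-, δ, -, hδ, he⟩ := he
  obtain ⟨-, δ', -, hδ', hf⟩ := hf
  have key : ∀ (n : ℕ) (a : ℕ → ℝ), 0 < n → (∀ j < n, |a j| ≤ 1) →
      ‖∑ j ∈ Finset.range n, a j • e j‖ = ‖∑ j ∈ Finset.range n, a j • f j‖ := by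
    intro n a hn ha
    have hb : ∀ᶠ l in atTop, |‖∑ j ∈ Finset.range n, a j • e j‖
        - ‖∑ j ∈ Finset.range n, a j • f j‖| ≤ δ l + δ' l := by
      filter_upwards [eventually_ge_atTop n] with l hl
      obtain ⟨S, hS, hSM⟩ := hlarge.exists_isPlegmaUpTo hM hne l n
      have h1 := he l n hn (by omega) a ha S hS (fun j _ b hb => (hSM j b hb).1)
        fun b hb => (hSM 0 b hb).2
      have h2 := hf l n hn (by omega) a ha S hS (fun j _ b hb => (hSM j b hb).1)
        fun b hb => (hSM 0 b hb).2
      rw [abs_le] at h1 h2 ⊢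
      constructor <;> linarith [h1.1, h1.2, h2.1, h2.2]
    have hlim := hδ.add hδ'
    rw [add_zero] at hlim
    have h := ge_of_tendsto hlim hb
    exact sub_eq_zero.1 (abs_eq_zero.1 (le_antisymm h (abs_nonneg _)))
  intro n a
  rcases Nat.eq_zero_or_pos n with rfl | hn
  · simp
  set C := 1 + ∑ j ∈ Finset.range n, |a j| with hC
  have hCpos : 0 < C := by
    have := Finset.sum_nonneg (s := Finset.range n) (f := fun j => |a j|) fun _ _ => abs_nonneg _
    positivity
  have h := key n (fun j => C⁻¹ * a j) hn (fun j hj => by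
    rw [abs_mul, abs_of_pos (inv_pos.2 hCpos), inv_mul_le_iff₀ hCpos, mul_one]
    have := Finset.single_le_sum (f := fun j => |a j|) (fun _ _ => abs_nonneg _)
      (Finset.mem_range.2 hj)
    linarith)
  simp only [mul_smul, ← Finset.smul_sum, norm_smul] at h
  exact mul_left_cancel₀ (norm_ne_zero_iff.2 (inv_pos.2 hCpos).ne') h

end Generation

/-! ### Construction of the slots -/

section Construction

variable {X : Type u} [NormedAddCommGroup X] [NormedSpace ℝ X]
  {G : Type v} [NormedAddCommGroup G] [NormedSpace ℝ G] {F : Set (Finset ℕ)}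

theorem SlotScheme.approximates {A : SlotScheme F} {x : F → X} {e : ℕ → G} {M : Set ℕ} {δ : ℕ → ℝ}
    (h : SpreadingModelEstimate x M e δ) (hM : ∀ i, A.μ i ∈ M) {lam : ℕ → ℕ}
    (hlam : ∀ i, i + A.ν i + A.ν (i + 1) ≤ lam i) (hδ : ∀ i, δ (lam i) ≤ (1 / 2) ^ i)
    (hmark : ∀ i, Nat.nth (· ∈ M) (lam i) ≤ A.mark i) : A.Approximates x e := by
  intro i p q c d S T hp hpq hc hd hS hT hST hSM hTM hSi
  have h1 := hlam i
  have h2 := hS.append hT hST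
  have key := h (lam i) (p + q) (by omega) (by omega) (fun j => if j < p then c j else d (j - p))
    (fun j hj => by
      split_ifs with h
      · exact hc j h
      · exact hd _ (by omega))
    (fun j => if j < p then S j else T (j - p))
    (by simpa only [apply_ite Subtype.val] using h2)
    (fun j hj b hb => by
      split_ifs at hb with h
      · obtain ⟨m, rfl⟩ := hSM j h b hb
        exact hM m
      · obtain ⟨m, rfl⟩ := hTM _ (by omega) b hb
        exact hM m)
    (fun b hb => by
      simp only [hp, if_true] at hb
      exact (hmark i).trans (hSi b hb))
  refine le_trans (le_of_eq ?_) (key.trans (hδ i))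
  rw [Finset.sum_range_add, Finset.sum_range_add]
  simp only [add_tsub_cancel_left, not_lt.2 (Nat.le_add_right p _), if_false]
  congr 4
  · apply Finset.sum_congr rfl
    intro j hj
    simp [Finset.mem_range.1 hj]
  · apply Finset.sum_congr rfl
    intro j hj
    simp [Finset.mem_range.1 hj]

theorem exists_slotScheme (hF : IsRegularThin F) (hne : ∃ s ∈ F, s.Nonempty) {M : Set ℕ}
    (hM : M.Infinite) {x : F → X} {e : ℕ → G} {y : G} {δ : ℕ → ℝ}
    (hδ : Tendsto δ atTop (𝓝 0)) (hx : SpreadingModelEstimate x M e δ) (hy : HasUniformMean e y) :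
    ∃ A : SlotScheme F, (∀ i, A.μ i ∈ M) ∧ IsVeryLarge F (Set.range A.μ) ∧
      (∀ i, i + 1 ≤ A.ν i) ∧ A.HasMeans e y ∧ A.Approximates x e := by
  obtain ⟨μ, hμ, hμM, hlarge⟩ := hF.exists_isVeryLarge
    (by obtain ⟨s, hs, -⟩ := hne; exact ⟨s, hs⟩) hM
  have hpos : ∀ i : ℕ, (0 : ℝ) < (1 / 2) ^ i := fun i => by positivity
  choose R hR0 hR using fun i : ℕ => hy _ (hpos i)
  set ν : ℕ → ℕ := fun i => i + 1 + ∑ p ∈ Finset.range (i + 1), R p with hν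
  have hνmono : Monotone ν := monotone_nat_of_le_succ fun i => by
    simp only [hν]
    rw [Finset.sum_range_succ _ (i + 1)]
    omega
  have hνR : ∀ i, R i ≤ ν i := fun i => by
    simp only [hν]
    rw [Finset.sum_range_succ]
    omega
  -- This length admits `i + 1` given sets followed by `ν i` paths, and also two families of `ν i`
  -- and `ν (i + 1)` paths.
  have hlam : ∀ i, ∃ l, i + ν i + ν (i + 1) ≤ l ∧ δ l ≤ (1 / 2) ^ i := fun i =>
    ((eventually_ge_atTop _).and (hδ.eventually_le_const (hpos i))).exists
  choose lam hlam1 hlam2 using hlam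
  set S : ℕ → ℕ := fun i =>
    ∑ p ∈ Finset.range (i + 1), (1 + (p + 1) * ν p + Nat.nth (· ∈ M) (lam p)) with hS
  have hSstep : ∀ p, S p + (p + 1) * ν p < S (p + 1) := fun p => by
    have h1 : S (p + 1)
        = S p + (1 + (p + 1 + 1) * ν (p + 1) + Nat.nth (· ∈ M) (lam (p + 1))) :=
      Finset.sum_range_succ _ (p + 1)
    have h2 : (p + 1) * ν p ≤ (p + 1 + 1) * ν (p + 1) :=
      Nat.mul_le_mul (by omega) (hνmono (by omega))
    omega
  have hSM : ∀ i, Nat.nth (· ∈ M) (lam i) ≤ S i := fun i => by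
    have h1 : S i = _ + (1 + (i + 1) * ν i + Nat.nth (· ∈ M) (lam i)) :=
      Finset.sum_range_succ _ i
    omega
  have hseg : ∀ B : ℕ → ℕ, ∃ t : F, StrictMono B → (∀ m, B m ∈ Set.range μ) →
      ∃ c, 0 < c ∧ (t : Finset ℕ) = (Finset.range c).image B := by
    intro B
    by_cases hB : StrictMono B ∧ ∀ m, B m ∈ Set.range μ
    · obtain ⟨c, hc⟩ := hlarge B hB.1 hB.2
      refine ⟨⟨_, hc⟩, fun _ _ => ⟨c, Nat.pos_of_ne_zero ?_, rfl⟩⟩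
      rintro rfl
      simpa using hF.1.nonempty_of_mem hne hc
    · obtain ⟨s, hs, -⟩ := hne
      exact ⟨⟨s, hs⟩, fun h1 h2 => absurd ⟨h1, h2⟩ hB⟩
  choose seg hseg using hseg
  refine ⟨⟨μ, ν, S, seg, hμ, hνmono, hSstep, hseg⟩, hμM, hlarge, fun i => ?_, fun i r hr P hP => ?_,
    SlotScheme.approximates hx hμM hlam1 hlam2 fun i => (hSM i).trans (hμ.id_le _)⟩
  · exact Nat.le_add_right _ _
  · exact hR i r ((hνR i).trans hr) P hP

theorem SlotScheme.generatesSpreadingModel {A : SlotScheme F} {x : F → X} {e : ℕ → G} {y : G}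
    (hx : A.Approximates x e) (he : A.HasMeans e y) (hν : ∀ i, i + 1 ≤ A.ν i) {z : X}
    (hz : ∀ i, ‖A.pathMean x (fun m => i + m) i - z‖ ≤ 5 * (1 / 2) ^ i)
    (hli : LinearIndependent ℝ fun n => e n - y) :
    GeneratesSpreadingModel (fun s => x s - z) (Set.range A.mark) (fun n => e n - y) := by
  rw [generatesSpreadingModel_iff]
  refine ⟨hli, fun l => (6 * (l + 1) + 1) * (1 / 2) ^ l, fun l => by positivity, ?_,
    fun l n hn hnl a ha S hS hSL hSl => ?_⟩
  · have h1 := tendsto_self_mul_const_pow_of_lt_one (r := 1 / 2) (by norm_num) (by norm_num)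
    have h2 := tendsto_pow_atTop_nhds_zero_of_lt_one (r := (1 : ℝ) / 2) (by norm_num) (by norm_num)
    have h3 := (h1.const_mul 6).add (h2.const_mul 7)
    simp only [mul_zero, add_zero] at h3
    refine h3.congr fun l => ?_
    ring
  · rw [nth_mem_range A.mark_mono] at hSl
    exact abs_norm_sum_sub_le hx he hν hz hn hnl ha hS hSL hSl

end Construction

/-! ### Passage to the completion and conclusion -/

section Completion

variable {E : Type v} [SeminormedAddCommGroup E] [NormedSpace ℝ E]

theorem norm_sum_smul_coe_completion {ι : Type*} (s : Finset ι) (a : ι → ℝ) (e : ι → E) :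
    ‖∑ j ∈ s, a j • (e j : UniformSpace.Completion E)‖ = ‖∑ j ∈ s, a j • e j‖ := by
  rw [← LinearIsometry.norm_map (UniformSpace.Completion.toComplₗᵢ (𝕜 := ℝ) (E := E)), map_sum]
  simp

theorem IsSingularSeq.coe_completion {e : ℕ → E} (h : IsSingularSeq e) :
    IsSingularSeq fun n => (e n : UniformSpace.Completion E) := by
  obtain ⟨h1, h2, h3⟩ := h
  refine ⟨fun n a k hk => ?_, fun h => h2 fun n m => ?_, ?_⟩
  · rw [norm_sum_smul_coe_completion, norm_sum_smul_coe_completion]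
    exact h1 n a k hk
  · have := h n m
    rwa [← UniformSpace.Completion.coe_sub, UniformSpace.Completion.norm_coe] at this
  · simpa only [IsSchauderBasic, norm_sum_smul_coe_completion] using h3

end Completion

theorem theorem6p16 {X : Type u} [NormedAddCommGroup X] [NormedSpace ℝ X] [CompleteSpace X]
    {E : Type v} [SeminormedAddCommGroup E] [NormedSpace ℝ E]
    (F : Set (Finset ℕ)) (hF : IsRegularThin F) (hne : ∃ s ∈ F, s.Nonempty)
    (M : Set ℕ) (hM : M.Infinite) (x : F → X) (e : ℕ → E)
    (hgen : GeneratesSpreadingModel x M e) (hsing : IsSingularSeq e) :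
    (∃ (e₀ : UniformSpace.Completion E) (e' : ℕ → UniformSpace.Completion E),
      IsNaturalDecomposition e e₀ e') ∧
    ∀ (e₀ : UniformSpace.Completion E) (e' : ℕ → UniformSpace.Completion E),
      IsNaturalDecomposition e e₀ e' →
      ∃ (z : X) (L : Set ℕ), ‖z‖ = ‖e₀‖ ∧ L ⊆ M ∧ L.Infinite ∧
        AdmitsUniqueSpreadingModel.{u, v, w} (fun s => x s - z) L e' := by
  have hsing' := hsing.coe_completion
  obtain ⟨y, hy⟩ := hsing'.exists_hasUniformMean
  refine ⟨⟨y, fun n => e n - y, fun f => hy.weak_tendsto f, fun n => by simp⟩, ?_⟩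
  rintro e₀ e' ⟨hweak, hdec⟩
  -- Weak limits are unique, so every natural decomposition is the one given by `y`.
  obtain rfl : y = e₀ := hy.eq_of_weak_tendsto hweak
  obtain rfl : e' = fun n => (e n : UniformSpace.Completion E) - y :=
    funext fun n => eq_sub_of_add_eq (hdec n).symm
  have hli : LinearIndependent ℝ fun n => (e n : UniformSpace.Completion E) - y := by
    apply linearIndependent_of_norm_sum_range
    · intro n a P hP
      exact hy.norm_sum_sub hsing'.1 n a hP
    · intro n h
      exact hsing'.1.ne_succ hsing'.2.1 n (sub_left_injective h)
  obtain ⟨-, δ, -, hδ, hx⟩ := generatesSpreadingModel_iff.1 hgen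
  have hx' : SpreadingModelEstimate x M (fun n => (e n : UniformSpace.Completion E)) δ := by
    simpa only [SpreadingModelEstimate, norm_sum_smul_coe_completion] using hx
  obtain ⟨A, hAM, hlarge, hν, hmeans, happ⟩ := exists_slotScheme hF hne hM hδ hx' hy
  obtain ⟨z, hz⟩ := SlotScheme.exists_limit_pathMean happ hmeans hν
  have hLμ : Set.range A.mark ⊆ Set.range A.μ := by
    rintro _ ⟨p, rfl⟩
    exact ⟨A.S p, rfl⟩
  have hL : (Set.range A.mark).Infinite := Set.infinite_range_of_injective A.mark_mono.injective
  have hg := SlotScheme.generatesSpreadingModel happ hmeans hν hz hli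
  refine ⟨z, Set.range A.mark, SlotScheme.norm_limit_eq happ hmeans hν hz, ?_, hL,
    ⟨_, subset_rfl, hL, hg⟩, fun N hNL hN H _ _ f hf => ?_⟩
  · rintro _ ⟨p, rfl⟩
    exact hAM _
  · exact (hg.mono hN hNL).isIsometricSeq hf hN (hlarge.mono (hNL.trans hLμ))
      fun t ht => hF.1.nonempty_of_mem hne ht
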